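/- **Setting.** Let $(M,d)$ be a metric space with a Borel probability measure $m$ and let $T\colon M\to M$ be a nonsingular map (measurable, $T_*m\ll m$). Assume that there are a measurable $Y\subset M$ with $m(Y)>0$ and $\operatorname{diam}Y\le 1$, an at most countable measurable partition $\alpha$ of $Y$ modulo an $m$-null set, with $m(a)>0$ for $a\in\alpha$, and $\tau\colon Y\to\{1,2,\dots\}$ with $\int_Y\tau\,dm<\infty$, constant on each $a\in\alpha$, such that $F y=T^{\tau(y)}y$ maps each $a\in\alpha$ into $Y$. Assume that there are $\lambda>1$ and $\hat K\ge 0$ such that for each $a\in\alpha$ and $x,y\in a$: $F$ restricts to a measure-theoretic bijection from $a$ onto $Y$; $d(Fx,Fy)\ge\lambda d(x,y)$; and $|\log\zeta_m(x)-\log\zeta_m(y)|\le\hat K d(Fx,Fy)$, where $\zeta_m=\frac{dm}{dm\circ F}$ is the inverse Jacobian of $F$. For a measure $\mu$ and $K\ge 0$ we say that $\mu$ has *distortion bound* $K$ if $\zeta=\frac{d\mu}{d\mu\circ F}$ satisfies $|\log\zeta(x)-\log\zeta(y)|\le K d(Fx,Fy)$ for all $x,y\in a$, $a\in\alpha$.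 Given $\mu$ and $R'$, a probability measure $\rho$ on $M$ is *regular* if it is supported on $Y$ and $d\rho=\phi\,d\mu$ with $\phi\colon Y\to(0,\infty)$ such that $|\log\phi(x)-\log\phi(y)|\le R' d(x,y)$ for all $x,y\in Y$. A probability measure $\rho$ on $M$ is *forward regular* if $\rho=\int_E\rho_z\,d\varkappa(z)$, where $(E,\varkappa)$ is a probability space, $\{\rho_z\}$ is a measurable family of probability measures on $M$, and there is a measurable $r\colon E\to\{0,1,2,\dots\}$ (a *jump function*) such that $T_*^{r(z)}\rho_z$ is regular for each $z$. Let $$s(x,y)=\inf\{\max\{k,n\}\colon k,n\ge 0,\ T^kx=T^ny\}\in\{0,1,2,\dots\}\cup\{\infty\}.$$ **Theorem.** There is a unique $F$-invariant probability measure $\mu$ on $Y$ with $\mu\ll m$. There is a constant $K=K(\lambda,\hat K)>0$, depending continuously and only on $\lambda$ and $\hat K$, such that $K^{-1}\le\frac{d\mu}{dm_Y}\le K$ almost everywhere on $Y$, where $m_Y=m(\cdot\cap Y)/m(Y)$, and such that $\mu$ has distortion bound $K$. Let $K\ge 0$ be any constant such that $\mu$ has distortion bound $K$, let $R'>K\lambda/(\lambda-1)$,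 and let $\rho$ be forward regular, with $(E,\varkappa)$, $\{\rho_z\}$ and $r$ as above. Then there is a probability measure $\hat\rho$ on $M\times M$ with marginals $\rho$ and $\mu$ on the first and second components such that $s<\infty$ $\hat\rho$-almost surely. Moreover $\hat\rho$ can be chosen so that all of the following hold: (a) If $\beta>1$, $C_\beta>0$, and $\varkappa(r\ge n)\le C_\beta n^{-\beta}$ and $\mu(\tau\ge n)\le C_\beta n^{-\beta}$ for all $n\ge1$, then $\hat\rho(s\ge n)\le C n^{-\beta}$ for all $n\ge 1$. (b) If $\beta>1$, $C_\beta>0$, $\int r^\beta\,d\varkappa\le C_\beta$ and $\int\tau^\beta\,d\mu\le C_\beta$, then $\int s^\beta\,d\hat\rho\le C$. (c) If $\theta>0$, $\gamma\in(0,1]$, $C_{\theta,\gamma}>0$, and $\varkappa(r\ge n)\le C_{\theta,\gamma}e^{-\theta n^\gamma}$ and $\mu(\tau\ge n)\le C_{\theta,\gamma}e^{-\theta n^\gamma}$ for all $n\ge1$, then $\hat\rho(s\ge n)\le Ce^{-An^\gamma}$ for all $n\ge1$. In (a) and (b) the constants $C$ depend continuously and only on $\lambda,K,R',\beta,C_\beta$;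 in (c) the constants $C>0$ and $A>0$ depend continuously and only on $\lambda,K,R',\theta,\gamma,C_{\theta,\gamma}$. (Where $s$ is not measurable, $\hat\rho(s\ge n)$ is an outer measure and $\int s^\beta\,d\hat\rho$ an upper integral.) -/

import Mathlib

open MeasureTheory ProbabilityTheory Set
open scoped ENNReal NNReal

/-- The induced map `F y = T^{τ(y)} y`. It is only used on `Y`, where the return time `τ` lives;
values of `τ` outside `Y` are irrelevant. -/
def inducedMap {M : Type*} (T : M → M) (τ : M → ℕ) (x : M) : M := T^[τ x] x

/-- `ζ = dν / d(ν ∘ F)` is the inverse Jacobian of `F` with respect to `ν` on the elements of `α`,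
in a version with values in `(0, ∞)`: the measure `A ↦ ν (F A)` on each `a ∈ α` has density `1 / ζ`
with respect to `ν`. -/
def IsInverseJacobian {M : Type*} [MeasurableSpace M] (F : M → M) (α : Set (Set M))
    (ν : Measure M) (ζ : M → ℝ) : Prop :=
  ∀ a ∈ α, (∀ x ∈ a, 0 < ζ x) ∧
    ∀ A : Set M, MeasurableSet A → A ⊆ a →
      ν (F '' A) = ∫⁻ x in A, ENNReal.ofReal (ζ x)⁻¹ ∂ν

/-- The inverse Jacobian `ζ` of `F` with respect to `ν` satisfies
`|log ζ x - log ζ y| ≤ K d(F x, F y)` for all `x, y ∈ a`, `a ∈ α`. -/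
def HasBoundedDistortion {M : Type*} [MetricSpace M] [MeasurableSpace M] (F : M → M)
    (α : Set (Set M)) (ν : Measure M) (K : ℝ) : Prop :=
  ∃ ζ : M → ℝ, IsInverseJacobian F α ν ζ ∧
    ∀ a ∈ α, ∀ x ∈ a, ∀ y ∈ a,
      |Real.log (ζ x) - Real.log (ζ y)| ≤ K * dist (F x) (F y)

/-- `T` is a nonuniformly expanding map of the metric probability space `(M, m)`, with inducing set
`Y` of diameter at most `1`, partition `α` of `Y` modulo a null set, return time `τ`, expansion
constant `lam` and distortion constant `Khat` (with Hölder exponent `1`). -/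
structure IsNonuniformlyExpanding {M : Type*} [MetricSpace M] [MeasurableSpace M]
    (T : M → M) (m : Measure M) (Y : Set M) (α : Set (Set M)) (τ : M → ℕ)
    (lam Khat : ℝ) : Prop where
  /-- `T` is nonsingular: measurable with `T_* m ≪ m` -/
  nonsingular : Measure.QuasiMeasurePreserving T m m
  measurableSet_Y : MeasurableSet Y
  measure_Y_pos : 0 < m Y
  diam_le_one : ∀ x ∈ Y, ∀ y ∈ Y, dist x y ≤ 1
  countable_partition : α.Countable
  measurableSet_of_mem : ∀ a ∈ α, MeasurableSet a
  subset_Y : ∀ a ∈ α, a ⊆ Y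
  disjoint : α.PairwiseDisjoint id
  cover : m (Y \ ⋃₀ α) = 0
  measure_pos : ∀ a ∈ α, 0 < m a
  one_le_τ : ∀ y ∈ Y, 1 ≤ τ y
  τ_const : ∀ a ∈ α, ∃ k : ℕ, ∀ x ∈ a, τ x = k
  τ_integrable : ∫⁻ y in Y, (τ y : ℝ≥0∞) ∂m < ⊤
  mapsTo : ∀ a ∈ α, MapsTo (inducedMap T τ) a Y
  one_lt_lam : 1 < lam
  Khat_nonneg : 0 ≤ Khat
  /-- `F` is a measure-theoretic bijection from `a` onto `Y` (next three fields) -/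
  injOn : ∀ a ∈ α, InjOn (inducedMap T τ) a
  image_measurable : ∀ a ∈ α, ∀ A : Set M, MeasurableSet A → A ⊆ a →
    NullMeasurableSet (inducedMap T τ '' A) m
  onto : ∀ a ∈ α, m (Y \ inducedMap T τ '' a) = 0
  expanding : ∀ a ∈ α, ∀ x ∈ a, ∀ y ∈ a,
    lam * dist x y ≤ dist (inducedMap T τ x) (inducedMap T τ y)
  distortion : HasBoundedDistortion (inducedMap T τ) α m Khat

/-- `μ` is an `F`-invariant probability measure on `Y`, absolutely continuous with respect to `m`,
viewed as a measure on `M`. -/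
structure IsInducedACIP {M : Type*} [MeasurableSpace M]
    (T : M → M) (m : Measure M) (Y : Set M) (τ : M → ℕ) (μ : Measure M) : Prop where
  isProbabilityMeasure : IsProbabilityMeasure μ
  supported : μ Yᶜ = 0
  absolutelyContinuous : μ ≪ m
  invariant : ∀ A : Set M, MeasurableSet A → μ (inducedMap T τ ⁻¹' A) = μ A

/-- A regular probability measure: supported on `Y` with a density `φ` with respect to `μ` such that
`log φ` is `R`-Lipschitz on `Y`. (The support condition follows, as `μ` is supported on `Y`.) -/
def IsRegularMeasure {M : Type*} [MetricSpace M] [MeasurableSpace M]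
    (Y : Set M) (μ : Measure M) (R : ℝ) (ρ : Measure M) : Prop :=
  IsProbabilityMeasure ρ ∧ ρ Yᶜ = 0 ∧
    ∃ φ : M → ℝ, (∀ x ∈ Y, 0 < φ x) ∧
      (∀ x ∈ Y, ∀ y ∈ Y, |Real.log (φ x) - Real.log (φ y)| ≤ R * dist x y) ∧
      ρ = μ.withDensity (fun x => ENNReal.ofReal (φ x))

/-- `ρ` is forward regular, with disintegration `ρ = ∫ ρ_z dκ(z)` over the probability space
`(E, κ)` and jump function `r`. -/
structure IsForwardRegular {M : Type*} [MetricSpace M] [MeasurableSpace M]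
    {E : Type*} [MeasurableSpace E] (T : M → M) (Y : Set M) (μ : Measure M) (R : ℝ)
    (ρ : Measure M) (κ : Measure E) (ρz : Kernel E M) (r : E → ℕ) : Prop where
  isProbabilityMeasure : IsProbabilityMeasure κ
  isMarkovKernel : IsMarkovKernel ρz
  disintegration : ρ = κ.bind ρz
  measurable_jump : Measurable r
  regular : ∀ z, IsRegularMeasure Y μ R ((ρz z).map (T^[r z]))

/-- `s(x, y) = inf {max(k, n) : k, n ≥ 0, T^k x = T^n y}`, with values in `ℕ ∪ {∞}`. -/
noncomputable def mergingTime {M : Type*} (T : M → M) (p : M × M) : ℕ∞ :=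
  ⨅ (k : ℕ) (n : ℕ) (_ : T^[k] p.1 = T^[n] p.2), ((max k n : ℕ) : ℕ∞)

/-- Admissible parameters `(lam, K, R, β, c)` for polynomial bounds. -/
def polyParams : Set (ℝ × ℝ × ℝ × ℝ × ℝ) :=
  {p | 1 < p.1 ∧ 0 ≤ p.2.1 ∧ p.2.1 * p.1 / (p.1 - 1) < p.2.2.1 ∧ 1 < p.2.2.2.1 ∧ 0 < p.2.2.2.2}

/-- Admissible parameters `(lam, K, R, a, γ, c)` for (stretched) exponential bounds. -/
def expParams : Set (ℝ × ℝ × ℝ × ℝ × ℝ × ℝ) :=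
  {p | 1 < p.1 ∧ 0 ≤ p.2.1 ∧ p.2.1 * p.1 / (p.1 - 1) < p.2.2.1 ∧ 0 < p.2.2.2.1 ∧
    (0 < p.2.2.2.2.1 ∧ p.2.2.2.2.1 ≤ 1) ∧ 0 < p.2.2.2.2.2}

/-- `ν (f ≥ n) ≤ c n^{-β}` for all `n ≥ 1`. -/
def WeakPolyTail {X : Type*} [MeasurableSpace X] (ν : Measure X) (f : X → ℕ∞) (β c : ℝ) : Prop :=
  ∀ n : ℕ, 1 ≤ n → ν {x | (n : ℕ∞) ≤ f x} ≤ ENNReal.ofReal (c * (n : ℝ) ^ (-β))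

/-- `ν (f ≥ n) ≤ c exp (-a n^γ)` for all `n ≥ 1`. -/
def ExpTail {X : Type*} [MeasurableSpace X] (ν : Measure X) (f : X → ℕ∞) (a γ c : ℝ) : Prop :=
  ∀ n : ℕ, 1 ≤ n → ν {x | (n : ℕ∞) ≤ f x} ≤ ENNReal.ofReal (c * Real.exp (-a * (n : ℝ) ^ γ))

/-- `∫ f^β dν ≤ c`. The integral is the upper integral, so that this is the expected bound also if
`f` is not measurable; for measurable `f` one can take `g = f`. -/
def MomentBound {X : Type*} [MeasurableSpace X] (ν : Measure X) (f : X → ℕ∞) (β c : ℝ) : Prop :=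
  ∃ g : X → ℝ≥0∞, Measurable g ∧ (∀ x, (f x : ℝ≥0∞) ≤ g x) ∧
    ∫⁻ x, g x ^ β ∂ν ≤ ENNReal.ofReal c

/-! The proof rests on one mechanism. The induced map `F` has full branches, expansion `λ` and
bounded distortion, so its transfer operator improves log-Lipschitz constants: a density with
constant `R` is sent to one with constant `R'' = R / λ + K`, and `R'' < R` by the choice of `R`. As
`Y` has diameter at most `1`, the image density is bounded below by a multiple of the mass, and a
fixed fraction `ε` of the mass, distributed as the reference measure `π`, can be subtracted so that
the remainder is `R`-log-Lipschitz again (`exists_split`). Iteration splits off the mass `ε (1 -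
ε)^n` at the step `n + 1` (`exists_split_seq`).

With `π = m_Y`, the normalised sum of the successive remainders of `π` is invariant
(`exists_invariant`). The same splitting shows that an invariant set carries at least its `π`-share
of every log-Lipschitz measure, whence ergodicity and uniqueness of `μ`.

With `π = μ`, the splitting is a coupling (`exists_stopping`, `exists_coupling`). A point `x` is
moved by `T^r`, after which its law is log-Lipschitz, and then by `F`; after each application of `F`
it is stopped with the probability given by the proportion of mass that splits off. The stopped
point `y` has law `μ`, and `y = T^j x` where `j` is `r` plus the sum of `n + 1` return times, `n`
being geometric. Hence `s ≤ j`. By `lintegral_mul_comp_le` each of these return times, even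
conditionally on the later stopping, has moments and tails at most `e^{3R}` times those under `μ`.
Polynomial bounds follow since one summand is at least the average; exponential ones since a small
fraction of the exponent makes the moment of each return time smaller than the geometric gain.

The space may be nonseparable and the given densities and Jacobians nonmeasurable. Log-Lipschitz
functions are therefore replaced by McShane extensions (`exists_harnackOn_extension`), mixtures are
treated by averages over balls (`HasLogLipschitzDensity.bind`), and `μ` is shown to live on a
separable set. -/

/-! ### Log-Lipschitz densities -/

section LogLipschitz

open Filter Topology

variable {M : Type*} [MetricSpace M]

/-- `g` is log-Lipschitz on `S` with constant `R`, in a form that allows the values `0` and `∞`. -/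
def HarnackOn (R : ℝ) (g : M → ℝ≥0∞) (S : Set M) : Prop :=
  ∀ x ∈ S, ∀ y ∈ S, g x ≤ ENNReal.ofReal (Real.exp (R * dist x y)) * g y

lemma HarnackOn.mono_const {R R' : ℝ} {g : M → ℝ≥0∞} {S : Set M} (h : HarnackOn R g S)
    (hR : R ≤ R') : HarnackOn R' g S := by
  intro x hx y hy
  refine (h x hx y hy).trans ?_
  gcongr

lemma HarnackOn.mono_set {R : ℝ} {g : M → ℝ≥0∞} {S S' : Set M} (h : HarnackOn R g S)
    (hS : S' ⊆ S) : HarnackOn R g S' :=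
  fun x hx y hy => h x (hS hx) y (hS hy)

lemma HarnackOn.mul {R R' : ℝ} {g g' : M → ℝ≥0∞} {S : Set M} (h : HarnackOn R g S)
    (h' : HarnackOn R' g' S) : HarnackOn (R + R') (g * g') S := by
  intro x hx y hy
  refine (mul_le_mul' (h x hx y hy) (h' x hx y hy)).trans (le_of_eq ?_)
  rw [add_mul, Real.exp_add, ENNReal.ofReal_mul (Real.exp_pos _).le, Pi.mul_apply]
  ring

lemma HarnackOn.tsum {ι : Type*} {R : ℝ} {g : ι → M → ℝ≥0∞} {S : Set M}
    (h : ∀ i, HarnackOn R (g i) S) : HarnackOn R (∑' i, g i) S := by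
  intro x hx y hy
  have hs : Summable g := Pi.summable.2 fun _ => ENNReal.summable
  rw [tsum_apply hs, tsum_apply hs, ← ENNReal.tsum_mul_left]
  exact ENNReal.tsum_le_tsum fun i => h i x hx y hy

lemma HarnackOn.const_mul {R : ℝ} {g : M → ℝ≥0∞} {S : Set M} (h : HarnackOn R g S) (c : ℝ≥0∞) :
    HarnackOn R (fun x => c * g x) S := by
  intro x hx y hy
  rw [mul_left_comm]
  exact mul_le_mul_right (h x hx y hy) c

lemma HarnackOn.le_of_diam {R : ℝ} {g : M → ℝ≥0∞} {Y : Set M} (hR : 0 ≤ R)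
    (hd : ∀ x ∈ Y, ∀ y ∈ Y, dist x y ≤ 1) (hg : HarnackOn R g Y) {x y : M} (hx : x ∈ Y)
    (hy : y ∈ Y) : g x ≤ ENNReal.ofReal (Real.exp R) * g y := by
  refine (hg x hx y hy).trans ?_
  gcongr
  exact mul_le_of_le_one_right hR (hd x hx y hy)

lemma HarnackOn.iInf {ι : Sort*} {R : ℝ} {g : ι → M → ℝ≥0∞} {S : Set M}
    (h : ∀ i, HarnackOn R (g i) S) : HarnackOn R (fun x => ⨅ i, g i x) S := by
  intro x hx y hy
  rw [ENNReal.mul_iInf_of_ne (by simp [Real.exp_pos]) ENNReal.ofReal_ne_top]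
  exact le_iInf fun i => (iInf_le _ i).trans (h i x hx y hy)

lemma exp_dist_triangle {R : ℝ} (hR : 0 ≤ R) (x y z : M) :
    ENNReal.ofReal (Real.exp (R * dist x z)) ≤
      ENNReal.ofReal (Real.exp (R * dist x y)) * ENNReal.ofReal (Real.exp (R * dist y z)) := by
  rw [← ENNReal.ofReal_mul (Real.exp_pos _).le, ← Real.exp_add, ← mul_add]
  gcongr
  exact dist_triangle x y z

lemma harnackOn_exp_dist {R : ℝ} (hR : 0 ≤ R) (p : M) (S : Set M) :
    HarnackOn R (fun x => ENNReal.ofReal (Real.exp (R * dist x p))) S :=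
  fun x _ y _ => exp_dist_triangle hR x y p

/-- The inequality bounds `g y` by a quantity that tends to `g x` as `y → x`, so `g` is upper
semicontinuous; where `g x = ∞` there is nothing to show. -/
lemma HarnackOn.measurable [MeasurableSpace M] [BorelSpace M] {R : ℝ} {g : M → ℝ≥0∞}
    (h : HarnackOn R g univ) : Measurable g := by
  refine UpperSemicontinuous.measurable fun x c hc => ?_
  have hfin : g x ≠ ⊤ := hc.ne_top
  have hcont : Continuous fun y => ENNReal.ofReal (Real.exp (R * dist y x)) * g x := by
    refine ENNReal.continuous_mul_const hfin |>.comp ?_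
    exact ENNReal.continuous_ofReal.comp (by fun_prop)
  have := hcont.continuousAt (x := x)
  filter_upwards [this.eventually_lt_const (u := c) (by simpa using hc)] with y hy
  exact (h y (mem_univ _) x (mem_univ _)).trans_lt hy

/-- Multiplicative McShane extension. -/
lemma exists_harnackOn_extension [MeasurableSpace M] [BorelSpace M] {ι : Type*} {R : ℝ}
    (hR : 0 ≤ R) (p : ι → M) (v : ι → ℝ≥0∞)
    (h : ∀ i j, v i ≤ ENNReal.ofReal (Real.exp (R * dist (p i) (p j))) * v j) :
    ∃ G : M → ℝ≥0∞, Measurable G ∧ HarnackOn R G univ ∧ ∀ i, G (p i) = v i := by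
  have hH : HarnackOn R
      (fun y => ⨅ i, v i * ENNReal.ofReal (Real.exp (R * dist y (p i)))) univ :=
    HarnackOn.iInf fun i => (harnackOn_exp_dist hR (p i) univ).const_mul (v i)
  refine ⟨_, hH.measurable, hH, fun i => le_antisymm ((iInf_le _ i).trans (by simp)) ?_⟩
  exact le_iInf fun j => (h i j).trans_eq (mul_comm _ _)

lemma ofReal_le_of_abs_log_sub_le {a b c : ℝ} (ha : 0 < a) (hb : 0 < b)
    (h : |Real.log a - Real.log b| ≤ c) :
    ENNReal.ofReal a ≤ ENNReal.ofReal (Real.exp c) * ENNReal.ofReal b := by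
  rw [← ENNReal.ofReal_mul (Real.exp_pos _).le]
  apply ENNReal.ofReal_le_ofReal
  have := (abs_le.1 h).2
  calc a = Real.exp (Real.log a) := (Real.exp_log ha).symm
    _ ≤ Real.exp (c + Real.log b) := by gcongr; linarith
    _ = _ := by rw [Real.exp_add, Real.exp_log hb]

end LogLipschitz

/-! ### Comparison of a log-Lipschitz function with its mean -/

section Bounds

variable {M : Type*} [MetricSpace M] [MeasurableSpace M] {π : Measure M} {Y : Set M}

lemma HarnackOn.lintegral_le [IsProbabilityMeasure π] (hY : ∀ᵐ x ∂π, x ∈ Y) {R : ℝ}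
    {g : M → ℝ≥0∞} (hR : 0 ≤ R) (hd : ∀ x ∈ Y, ∀ y ∈ Y, dist x y ≤ 1) (hg : HarnackOn R g Y)
    {y : M} (hy : y ∈ Y) : ∫⁻ x, g x ∂π ≤ ENNReal.ofReal (Real.exp R) * g y :=
  calc ∫⁻ x, g x ∂π ≤ ∫⁻ _, ENNReal.ofReal (Real.exp R) * g y ∂π :=
        lintegral_mono_ae (hY.mono fun x hx => hg.le_of_diam hR hd hx hy)
    _ = _ := by simp

lemma HarnackOn.le_lintegral [IsProbabilityMeasure π] (hY : ∀ᵐ x ∂π, x ∈ Y) {R : ℝ}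
    {g : M → ℝ≥0∞} (hR : 0 ≤ R) (hd : ∀ x ∈ Y, ∀ y ∈ Y, dist x y ≤ 1) (hg : HarnackOn R g Y)
    {y : M} (hy : y ∈ Y) : g y ≤ ENNReal.ofReal (Real.exp R) * ∫⁻ x, g x ∂π :=
  calc g y = ∫⁻ _, g y ∂π := by simp
    _ ≤ ∫⁻ x, ENNReal.ofReal (Real.exp R) * g x ∂π :=
        lintegral_mono_ae (hY.mono fun x hx => hg.le_of_diam hR hd hy hx)
    _ = _ := lintegral_const_mul' _ _ ENNReal.ofReal_ne_top

end Bounds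

/-- The mass fraction `ε` of the reference measure that can be split off the image of a
log-Lipschitz measure. -/
noncomputable def splitFraction (lam K R : ℝ) : ℝ :=
  -- The exponential bounds the image density from below by the mass; the second factor leaves room
  -- for the remainder to be `R`-log-Lipschitz.
  Real.exp (-(R / lam + K)) * (1 - (R / lam + K) / R)

/-! ### Arithmetic of the split fraction -/

section SplitFraction

variable {lam K R : ℝ}

lemma rate_pos (hlam : 1 < lam) (hK : 0 ≤ K) (hR : K * lam / (lam - 1) < R) : 0 < R :=
  (div_nonneg (mul_nonneg hK (by linarith)) (by linarith)).trans_lt hR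

lemma contracted_rate_lt (hlam : 1 < lam) (hR : K * lam / (lam - 1) < R) :
    R / lam + K < R := by
  have h1 : 0 < lam - 1 := by linarith
  rw [div_lt_iff₀ h1] at hR
  have h2 : 0 < lam := by linarith
  rw [← sub_pos]
  have : R - (R / lam + K) = (R * (lam - 1) - K * lam) / lam := by field_simp; ring
  rw [this]
  exact div_pos (by linarith) h2

lemma contracted_rate_pos (hlam : 1 < lam) (hK : 0 ≤ K) (hR : K * lam / (lam - 1) < R) :
    0 < R / lam + K :=
  add_pos_of_pos_of_nonneg (div_pos (rate_pos hlam hK hR) (by linarith)) hK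

lemma splitFraction_pos (hlam : 1 < lam) (hK : 0 ≤ K) (hR : K * lam / (lam - 1) < R) :
    0 < splitFraction lam K R := by
  refine mul_pos (Real.exp_pos _) ?_
  rw [sub_pos, div_lt_one (rate_pos hlam hK hR)]
  exact contracted_rate_lt hlam hR

lemma splitFraction_lt_one (hlam : 1 < lam) (hK : 0 ≤ K) (hR : K * lam / (lam - 1) < R) :
    splitFraction lam K R < 1 := by
  have h0 := contracted_rate_pos hlam hK hR
  have h1 : Real.exp (-(R / lam + K)) ≤ 1 := Real.exp_le_one_iff.2 (by linarith)
  have h2 : 0 < (R / lam + K) / R := div_pos h0 (rate_pos hlam hK hR)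
  have h3 : (R / lam + K) / R < 1 := by
    rw [div_lt_one (rate_pos hlam hK hR)]; exact contracted_rate_lt hlam hR
  unfold splitFraction
  nlinarith [Real.exp_pos (-(R / lam + K))]

/-- Convexity of `exp` between `0` and `R d`, with weight `R'' / R` on the second point. -/
lemma exp_sub_one_mul_le {R'' R d : ℝ} (hR : 0 < R) (h0 : 0 ≤ R'') (hlt : R'' ≤ R) :
    (Real.exp (R * d) - 1) * (1 - R'' / R) ≤ Real.exp (R * d) - Real.exp (R'' * d) := by
  have ht0 : 0 ≤ R'' / R := by positivity
  have ht1 : R'' / R ≤ 1 := (div_le_one hR).2 hlt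
  have := convexOn_exp.2 (mem_univ (0 : ℝ)) (mem_univ (R * d)) (sub_nonneg.2 ht1) ht0 (by ring)
  simp only [smul_eq_mul, mul_zero, zero_add, Real.exp_zero, mul_one] at this
  have h2 : R'' / R * (R * d) = R'' * d := by field_simp
  rw [h2] at this
  linarith

/-- Subtracting a constant worsens the log-Lipschitz constant from `R''` to at most `R`: the claim
amounts to `(e^{Rd} - 1) ε p ≤ (e^{Rd} - e^{R''d}) gy`, where `ε = e^{-R''} (1 - R'' / R)`, and
`e^{-R''} p ≤ gy` reduces it to convexity. -/
lemma sub_harnack_real {R'' R d p gx gy : ℝ} (hR : 0 < R) (h0 : 0 ≤ R'') (hlt : R'' ≤ R)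
    (hd : 0 ≤ d) (hgy : 0 ≤ gy) (hgx : gx ≤ Real.exp (R'' * d) * gy) (hp : p ≤ Real.exp R'' * gy) :
    gx - Real.exp (-R'') * (1 - R'' / R) * p ≤
      Real.exp (R * d) * (gy - Real.exp (-R'') * (1 - R'' / R) * p) := by
  have ht1 : 0 ≤ 1 - R'' / R := sub_nonneg.2 ((div_le_one hR).2 hlt)
  have hp' : Real.exp (-R'') * p ≤ gy := by
    rw [Real.exp_neg, inv_mul_le_iff₀ (Real.exp_pos _)]; exact hp
  have hE : 0 ≤ Real.exp (R * d) - 1 := sub_nonneg.2 (Real.one_le_exp (by positivity))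
  have h1 := exp_sub_one_mul_le (d := d) hR h0 hlt
  have h2 : (Real.exp (R * d) - 1) * (1 - R'' / R) * (Real.exp (-R'') * p) ≤
      (Real.exp (R * d) - Real.exp (R'' * d)) * gy :=
    (mul_le_mul_of_nonneg_left hp' (mul_nonneg hE ht1)).trans (mul_le_mul_of_nonneg_right h1 hgy)
  nlinarith

end SplitFraction

/-! ### Full-branch Markov systems with bounded distortion -/

/-- `ν` has a log-Lipschitz density on `Y` with respect to `π`. -/
def HasLogLipschitzDensity {M : Type*} [MetricSpace M] [MeasurableSpace M] (π : Measure M)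
    (Y : Set M) (R : ℝ) (ν : Measure M) : Prop :=
  ∃ g : M → ℝ≥0∞, Measurable g ∧ HarnackOn R g Y ∧ ν = π.withDensity g

/-- A uniformly expanding map with full branches on the elements of `α`, in terms of a reference
probability measure `π`; bounded distortion is expressed by the transfer operator. -/
structure MarkovSystem {M : Type*} [MetricSpace M] [MeasurableSpace M] (F : M → M)
    (π : Measure M) (Y : Set M) (α : Set (Set M)) (lam K : ℝ) : Prop where
  measurable_map : Measurable F
  isProbabilityMeasure : IsProbabilityMeasure π
  ae_mem : ∀ᵐ x ∂π, x ∈ Y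
  diam_le_one : ∀ x ∈ Y, ∀ y ∈ Y, dist x y ≤ 1
  countable : α.Countable
  measurableSet : ∀ a ∈ α, MeasurableSet a
  subset : ∀ a ∈ α, a ⊆ Y
  disjoint : α.PairwiseDisjoint id
  ae_cover : ∀ᵐ x ∂π, x ∈ ⋃₀ α
  mapsTo : ∀ a ∈ α, MapsTo F a Y
  one_lt_lam : 1 < lam
  nonneg : 0 ≤ K
  expanding : ∀ a ∈ α, ∀ x ∈ a, ∀ y ∈ a, lam * dist x y ≤ dist (F x) (F y)
  -- `j` is the transfer operator applied to the indicator of `a`, that is, the inverse Jacobian of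
  -- the branch read at the image point.
  transfer : ∀ a ∈ α, ∃ j : M → ℝ≥0∞, Measurable j ∧ HarnackOn K j Y ∧
    (π.restrict a).map F = π.withDensity j

lemma map_withDensity_comp {X X' : Type*} [MeasurableSpace X] [MeasurableSpace X']
    {ν : Measure X} {f : X → X'} {g : X' → ℝ≥0∞} (hf : Measurable f) (hg : Measurable g) :
    (ν.withDensity (fun x => g (f x))).map f = (ν.map f).withDensity g := by
  ext B hB
  rw [Measure.map_apply hf hB, withDensity_apply _ (hf hB), withDensity_apply _ hB,
    setLIntegral_map hB hg hf]

lemma lintegral_eq_of_map_eq_withDensity {X X' : Type*} [MeasurableSpace X] [MeasurableSpace X']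
    {ν : Measure X} {π : Measure X'} {f : X → X'} {g : X' → ℝ≥0∞} (hf : Measurable f)
    (h : ν.map f = π.withDensity g) : ∫⁻ x, g x ∂π = ν univ := by
  rw [← setLIntegral_univ, ← withDensity_apply _ MeasurableSet.univ, ← h,
    Measure.map_apply hf MeasurableSet.univ, preimage_univ]

lemma HasLogLipschitzDensity.sum {M : Type*} [MetricSpace M] [MeasurableSpace M] {π : Measure M}
    {Y : Set M} {R : ℝ} {ι : Type*} [Countable ι] {ν : ι → Measure M}
    (h : ∀ i, HasLogLipschitzDensity π Y R (ν i)) :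
    HasLogLipschitzDensity π Y R (Measure.sum ν) := by
  choose g hg hH hν using h
  refine ⟨∑' i, g i, ?_, HarnackOn.tsum hH, ?_⟩
  · have : (∑' i, g i) = fun x => ∑' i, g i x := by
      ext x; exact tsum_apply (Pi.summable.2 fun _ => ENNReal.summable)
    rw [this]
    exact Measurable.tsum hg
  · rw [withDensity_tsum hg]
    congr 1
    ext1 i
    exact hν i

namespace MarkovSystem

variable {M : Type*} [MetricSpace M] [MeasurableSpace M] {F : M → M}
  {π ν : Measure M} {Y : Set M} {α : Set (Set M)} {lam K R : ℝ}

lemma sum_restrict (S : MarkovSystem F π Y α lam K) (hν : ν ≪ π) :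
    ν = Measure.sum fun a : α => ν.restrict a := by
  have := S.countable.to_subtype
  rw [← Measure.restrict_iUnion, ← sUnion_eq_iUnion]
  · exact (Measure.restrict_eq_self_of_ae_mem (hν.ae_le S.ae_cover)).symm
  · intro a b hab
    exact S.disjoint a.2 b.2 (Subtype.coe_ne_coe.2 hab)
  · exact fun a => S.measurableSet a a.2

lemma map_eq_sum (S : MarkovSystem F π Y α lam K) (hν : ν ≪ π) :
    ν.map F = Measure.sum fun a : α => (ν.restrict a).map F := by
  conv_lhs => rw [S.sum_restrict hν]
  exact Measure.map_sum S.measurable_map.aemeasurable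

variable [BorelSpace M]

/-- The image density is the old density along the inverse branch times `j`. Expansion divides the
constant of the first factor by `lam`; the second contributes `K`. -/
lemma transfer_restrict (S : MarkovSystem F π Y α lam K) (hR : 0 ≤ R)
    (hν : HasLogLipschitzDensity π Y R ν) {a : Set M} (ha : a ∈ α) :
    HasLogLipschitzDensity π Y (R / lam + K) ((ν.restrict a).map F) := by
  obtain ⟨g, hg, hH, rfl⟩ := hν
  obtain ⟨j, hj, hjH, hja⟩ := S.transfer a ha
  have hlam : 0 < lam := by linarith [S.one_lt_lam]
  -- `G` plays the role of `g` composed with the inverse branch; it is prescribed on the image of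
  -- `a` only and extended from there, which makes it measurable.
  obtain ⟨G, hG, hGH, hGa⟩ := exists_harnackOn_extension (R := R / lam) (by positivity)
    (fun x : a => F x) (fun x : a => g x) (by
      intro x y
      refine (hH x (S.subset a ha x.2) y (S.subset a ha y.2)).trans ?_
      have := S.expanding a ha x x.2 y y.2
      have h2 : R * dist (x : M) y ≤ R / lam * dist (F x) (F y) := by
        rw [div_mul_eq_mul_div, le_div_iff₀ hlam]
        nlinarith
      gcongr)
  refine ⟨G * j, hG.mul hj, (hGH.mono_set (subset_univ _)).mul hjH, ?_⟩
  have hcongr : g =ᵐ[π.restrict a] fun x => G (F x) :=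
    (ae_restrict_mem (S.measurableSet a ha)).mono fun x hx => (hGa ⟨x, hx⟩).symm
  rw [restrict_withDensity (S.measurableSet a ha), withDensity_congr_ae hcongr,
    map_withDensity_comp S.measurable_map hG, hja, mul_comm, withDensity_mul _ hj hG]

lemma transfer_map (S : MarkovSystem F π Y α lam K) (hR : 0 ≤ R)
    (hν : HasLogLipschitzDensity π Y R ν) :
    HasLogLipschitzDensity π Y (R / lam + K) (ν.map F) := by
  have hac : ν ≪ π := by
    obtain ⟨g, -, -, rfl⟩ := hν
    exact withDensity_absolutelyContinuous _ _
  have := S.countable.to_subtype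
  rw [S.map_eq_sum hac]
  exact HasLogLipschitzDensity.sum fun a => S.transfer_restrict hR hν a.2

/-- A definite fraction of the reference measure splits off the image of a measure with
log-Lipschitz density. -/
lemma exists_split (S : MarkovSystem F π Y α lam K) (hR : K * lam / (lam - 1) < R)
    [IsFiniteMeasure ν] (hν : HasLogLipschitzDensity π Y R ν) :
    ∃ ν' : Measure M, HasLogLipschitzDensity π Y R ν' ∧
      ν.map F = ν' + (ENNReal.ofReal (splitFraction lam K R) * ν univ) • π := by
  have := S.isProbabilityMeasure
  have hR0 : 0 < R := rate_pos S.one_lt_lam S.nonneg hR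
  have hR'' := contracted_rate_pos S.one_lt_lam S.nonneg hR
  have hlt := contracted_rate_lt S.one_lt_lam hR
  have hε := splitFraction_pos S.one_lt_lam S.nonneg hR
  obtain ⟨g, hg, hH, hmap⟩ := S.transfer_map hR0.le hν
  set R'' := R / lam + K
  have hmass : ∫⁻ x, g x ∂π = ν univ :=
    lintegral_eq_of_map_eq_withDensity S.measurable_map hmap
  set p := ν univ
  have hp : p ≠ ⊤ := measure_ne_top ν univ
  have hfin : ∀ y ∈ Y, g y ≠ ⊤ := fun y hy => by
    refine ne_top_of_le_ne_top ?_ (hH.le_lintegral S.ae_mem hR''.le S.diam_le_one hy)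
    rw [hmass]
    exact ENNReal.mul_ne_top ENNReal.ofReal_ne_top hp
  have hple : ∀ y ∈ Y, p.toReal ≤ Real.exp R'' * (g y).toReal := fun y hy => by
    have := hH.lintegral_le S.ae_mem hR''.le S.diam_le_one hy
    rw [hmass] at this
    have := ENNReal.toReal_mono (ENNReal.mul_ne_top ENNReal.ofReal_ne_top (hfin y hy)) this
    rwa [ENNReal.toReal_mul, ENNReal.toReal_ofReal (Real.exp_pos _).le] at this
  -- Subtraction and `ENNReal.ofReal` are both truncated at `0`, so this identity needs no sign
  -- condition.
  have hreal : ∀ y ∈ Y, g y - ENNReal.ofReal (splitFraction lam K R) * p =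
      ENNReal.ofReal ((g y).toReal - splitFraction lam K R * p.toReal) := fun y hy => by
    rw [ENNReal.ofReal_sub _ (by positivity), ENNReal.ofReal_toReal (hfin y hy),
      ENNReal.ofReal_mul hε.le, ENNReal.ofReal_toReal hp]
  have hle : ∀ y ∈ Y, ENNReal.ofReal (splitFraction lam K R) * p ≤ g y := fun y hy => by
    rw [← ENNReal.ofReal_toReal hp, ← ENNReal.ofReal_mul hε.le,
      ← ENNReal.ofReal_toReal (hfin y hy)]
    apply ENNReal.ofReal_le_ofReal
    have h1 := hple y hy
    have h2 : Real.exp (-R'') * p.toReal ≤ (g y).toReal := by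
      rw [Real.exp_neg, inv_mul_le_iff₀ (Real.exp_pos _)]; exact h1
    have h3 : 1 - R'' / R ≤ 1 := by linarith [show 0 ≤ R'' / R by positivity]
    calc splitFraction lam K R * p.toReal = (1 - R'' / R) * (Real.exp (-R'') * p.toReal) := by
          unfold splitFraction; ring
      _ ≤ 1 * (Real.exp (-R'') * p.toReal) := by gcongr
      _ ≤ _ := by rwa [one_mul]
  refine ⟨π.withDensity fun x => g x - ENNReal.ofReal (splitFraction lam K R) * p,
    ⟨_, by fun_prop, ?_, rfl⟩, ?_⟩
  · intro x hx y hy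
    simp only
    rw [hreal x hx, hreal y hy, ← ENNReal.ofReal_mul (Real.exp_pos _).le]
    apply ENNReal.ofReal_le_ofReal
    refine sub_harnack_real hR0 hR''.le hlt.le dist_nonneg ENNReal.toReal_nonneg ?_ (hple y hy)
    have := ENNReal.toReal_mono (ENNReal.mul_ne_top ENNReal.ofReal_ne_top (hfin y hy))
      (hH x hx y hy)
    rwa [ENNReal.toReal_mul, ENNReal.toReal_ofReal (Real.exp_pos _).le] at this
  · rw [hmap, ← withDensity_const, ← withDensity_add_right _ measurable_const]
    refine withDensity_congr_ae (S.ae_mem.mono fun x hx => ?_)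
    simp only [Pi.add_apply]
    rw [tsub_add_cancel_of_le (hle x hx)]

/-- Conditionally on the image point, a function that is constant on the elements of the partition
has an average comparable to its average over the reference measure. -/
lemma lintegral_mul_comp_le (S : MarkovSystem F π Y α lam K) (hR : K * lam / (lam - 1) < R)
    [IsFiniteMeasure ν] (hν : HasLogLipschitzDensity π Y R ν) {f H : M → ℝ≥0∞}
    (hfα : ∀ a ∈ α, ∃ c, ∀ x ∈ a, f x = c) (hH : Measurable H) :
    ∫⁻ x, f x * H (F x) ∂ν ≤
      ENNReal.ofReal (Real.exp (3 * R)) * (∫⁻ x, f x ∂π) * ∫⁻ x, H (F x) ∂ν := by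
  have := S.isProbabilityMeasure
  have := S.countable.to_subtype
  have hR0 : 0 < R := rate_pos S.one_lt_lam S.nonneg hR
  have hlt := contracted_rate_lt S.one_lt_lam hR
  have hac : ν ≪ π := by
    obtain ⟨g, -, -, rfl⟩ := hν
    exact withDensity_absolutelyContinuous _ _
  obtain ⟨g, hg, hgH, hgmap⟩ := S.transfer_map hR0.le hν
  replace hgH := hgH.mono_const hlt.le
  have hmass : ∫⁻ x, g x ∂π = ν univ :=
    lintegral_eq_of_map_eq_withDensity S.measurable_map hgmap
  have hνa : ∀ a : Set M, a ∈ α → ν a ≤ ENNReal.ofReal (Real.exp R) * ν univ * π a := by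
    intro a ha
    obtain ⟨φ, hφ, hφH, rfl⟩ := hν
    rw [withDensity_apply _ (S.measurableSet a ha), withDensity_apply _ MeasurableSet.univ,
      setLIntegral_univ, ← setLIntegral_const]
    exact setLIntegral_mono_ae' (S.measurableSet a ha) (S.ae_mem.mono fun x hx _ =>
      hφH.le_lintegral S.ae_mem hR0.le S.diam_le_one hx)
  have key : ∀ a : α, ∫⁻ x in a, f x * H (F x) ∂ν ≤
      ENNReal.ofReal (Real.exp (3 * R)) * (∫⁻ x in a, f x ∂π) * ∫⁻ x, H (F x) ∂ν := by
    rintro ⟨a, ha⟩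
    obtain ⟨c, hc⟩ := hfα a ha
    obtain ⟨h, hh, hhH, hhmap⟩ := S.transfer_restrict hR0.le hν ha
    replace hhH := hhH.mono_const hlt.le
    have hhmass : ∫⁻ x, h x ∂π = ν a := by
      simpa using lintegral_eq_of_map_eq_withDensity S.measurable_map hhmap
    -- Three comparisons cost `e^R` each: `h` with its mean `ν a`, `ν a` with `ν univ * π a`, and
    -- the mean `ν univ` of `g` with `g`. This is the source of the constant `e^{3R}`.
    have hcompare : ∀ y ∈ Y, h y ≤ ENNReal.ofReal (Real.exp (3 * R)) * π a * g y := by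
      intro y hy
      have h1 := hhH.le_lintegral S.ae_mem hR0.le S.diam_le_one hy
      have h2 := hgH.lintegral_le S.ae_mem hR0.le S.diam_le_one hy
      rw [hhmass] at h1
      rw [hmass] at h2
      calc h y ≤ ENNReal.ofReal (Real.exp R) * ν a := h1
        _ ≤ ENNReal.ofReal (Real.exp R) * (ENNReal.ofReal (Real.exp R) *
            (ENNReal.ofReal (Real.exp R) * g y) * π a) := by
          gcongr; refine (hνa a ha).trans ?_; gcongr
        _ = ENNReal.ofReal (Real.exp (3 * R)) * π a * g y := by
          rw [show 3 * R = R + R + R by ring, Real.exp_add, Real.exp_add,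
            ENNReal.ofReal_mul (by positivity), ENNReal.ofReal_mul (by positivity)]
          ring
    have e1 : ∫⁻ x in a, f x * H (F x) ∂ν = c * ∫⁻ y, h y * H y ∂π := by
      rw [setLIntegral_congr_fun (g := fun x => c * H (F x)) (S.measurableSet a ha)
        (fun x hx => by simp only [hc x hx]),
        lintegral_const_mul c (show Measurable fun x => H (F x) from hH.comp S.measurable_map),
        ← lintegral_map (μ := ν.restrict a) hH S.measurable_map, hhmap,
        lintegral_withDensity_eq_lintegral_mul _ hh hH]
      rfl
    have e2 : ∫⁻ x in a, f x ∂π = c * π a := by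
      rw [setLIntegral_congr_fun (g := fun _ => c) (S.measurableSet a ha) (fun x hx => hc x hx),
        setLIntegral_const]
    have e3 : ∫⁻ x, H (F x) ∂ν = ∫⁻ y, g y * H y ∂π := by
      rw [← lintegral_map hH S.measurable_map, hgmap,
        lintegral_withDensity_eq_lintegral_mul _ hg hH]
      rfl
    rw [e1, e2, e3]
    calc c * ∫⁻ y, h y * H y ∂π
        ≤ c * ∫⁻ y, ENNReal.ofReal (Real.exp (3 * R)) * π a * (g y * H y) ∂π := by
          gcongr c * ?_
          refine lintegral_mono_ae (S.ae_mem.mono fun y hy => ?_)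
          rw [← mul_assoc]
          exact mul_le_mul_left (hcompare y hy) _
      _ = _ := by rw [lintegral_const_mul _ (show Measurable fun y => g y * H y from hg.mul hH)]; ring
  calc ∫⁻ x, f x * H (F x) ∂ν = ∑' a : α, ∫⁻ x in a, f x * H (F x) ∂ν := by
        conv_lhs => rw [S.sum_restrict hac]
        rw [lintegral_sum_measure]
    _ ≤ ∑' a : α, ENNReal.ofReal (Real.exp (3 * R)) * (∫⁻ x in a, f x ∂π) *
        ∫⁻ x, H (F x) ∂ν := ENNReal.tsum_le_tsum key
    _ = _ := by
        rw [ENNReal.tsum_mul_right, ENNReal.tsum_mul_left]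
        congr 2
        conv_rhs => rw [S.sum_restrict (Measure.AbsolutelyContinuous.refl π)]
        rw [lintegral_sum_measure]

end MarkovSystem

/-! ### Invariant measures of Markov systems -/

lemma tsum_ofReal_geometric {ε : ℝ} (h0 : 0 < ε) (h1 : ε ≤ 1) :
    ∑' n : ℕ, ENNReal.ofReal (ε * (1 - ε) ^ n) = 1 := by
  have hlt : 1 - ε < 1 := by linarith
  have h2 : 0 ≤ 1 - ε := by linarith
  rw [← ENNReal.ofReal_tsum_of_nonneg (fun n => by positivity)
    ((summable_geometric_of_lt_one h2 hlt).mul_left ε), tsum_mul_left,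
    tsum_geometric_of_lt_one h2 hlt]
  simp [h0.ne']

namespace MarkovSystem

variable {M : Type*} [MetricSpace M] [MeasurableSpace M] {F : M → M}
  {π ν : Measure M} {Y : Set M} {α : Set (Set M)} {lam K R : ℝ}

lemma hasLogLipschitzDensity_self (hR : 0 ≤ R) : HasLogLipschitzDensity π Y R π := by
  refine ⟨fun _ => 1, measurable_const, fun x _ y _ => ?_, by simp⟩
  rw [mul_one, ← ENNReal.ofReal_one]
  exact ENNReal.ofReal_le_ofReal (Real.one_le_exp (by positivity))

lemma ae_map_mem (S : MarkovSystem F π Y α lam K) {p : M → Prop} (hp : ∀ᵐ x ∂π, p x) :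
    ∀ᵐ x ∂π, p (F x) := by
  have hac : π.map F ≪ π := by
    have := S.countable.to_subtype
    rw [S.map_eq_sum (Measure.AbsolutelyContinuous.refl π)]
    refine Measure.absolutelyContinuous_sum_left fun a => ?_
    obtain ⟨j, -, -, hj⟩ := S.transfer a a.2
    rw [hj]
    exact withDensity_absolutelyContinuous _ _
  exact ae_of_ae_map S.measurable_map.aemeasurable (hac.ae_le hp)

/-- The sets are the cylinders of order `n`: pulling back along one branch shrinks diameters by the
factor `lam⁻¹`, starting from `Y`, of diameter at most `1`. -/
lemma exists_small_cover (S : MarkovSystem F π Y α lam K) (n : ℕ) :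
    ∃ 𝒞 : Set (Set M), 𝒞.Countable ∧ (∀ C ∈ 𝒞, ∀ x ∈ C, ∀ y ∈ C, dist x y ≤ (lam⁻¹) ^ n) ∧
      ∀ᵐ x ∂π, ∃ C ∈ 𝒞, x ∈ C := by
  have hlam : 0 < lam := by linarith [S.one_lt_lam]
  induction n with
  | zero =>
    exact ⟨{Y}, countable_singleton _, by simpa using S.diam_le_one, by simpa using S.ae_mem⟩
  | succ n ih =>
    obtain ⟨𝒞, hc, hd, hae⟩ := ih
    refine ⟨(fun p : Set M × Set M => p.1 ∩ F ⁻¹' p.2) '' (α ×ˢ 𝒞), (S.countable.prod hc).image _,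
      ?_, ?_⟩
    · rintro _ ⟨⟨a, C⟩, ⟨ha, hC⟩, rfl⟩ x ⟨hxa, hxC⟩ y ⟨hya, hyC⟩
      have h1 := S.expanding a ha x hxa y hya
      have h2 := hd C hC _ hxC _ hyC
      rw [pow_succ', ← div_eq_inv_mul, le_div_iff₀ hlam]
      linarith
    · filter_upwards [S.ae_cover, S.ae_map_mem hae] with x hx hFx
      obtain ⟨a, ha, hxa⟩ := hx
      obtain ⟨C, hC, hxC⟩ := hFx
      exact ⟨_, ⟨(a, C), ⟨ha, hC⟩, rfl⟩, hxa, hxC⟩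

/-- The reference measure is carried by a separable set. -/
lemma exists_countable_ae_mem_closure (S : MarkovSystem F π Y α lam K) :
    ∃ Q : Set M, Q.Countable ∧ ∀ᵐ x ∂π, x ∈ closure Q := by
  choose 𝒞 hc hd hae using S.exists_small_cover
  have hlam := S.one_lt_lam
  classical
  let pt : Set M → Set M := fun C => if h : C.Nonempty then {h.some} else ∅
  have hpt : ∀ C, (pt C).Countable := fun C => by
    by_cases h : C.Nonempty <;> simp [pt, h]
  refine ⟨⋃ n, ⋃ C ∈ 𝒞 n, pt C, countable_iUnion fun n => (hc n).biUnion fun C _ => hpt C, ?_⟩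
  filter_upwards [ae_all_iff.2 hae] with x hx
  rw [Metric.mem_closure_iff]
  intro ε hε
  obtain ⟨n, hn⟩ := exists_pow_lt_of_lt_one hε (inv_lt_one_of_one_lt₀ hlam)
  obtain ⟨C, hC, hxC⟩ := hx n
  have hne : C.Nonempty := ⟨x, hxC⟩
  refine ⟨hne.some, mem_iUnion.2 ⟨n, mem_iUnion₂.2 ⟨C, hC, by simp [pt, hne]⟩⟩, ?_⟩
  exact (hd n C hC x hxC _ hne.some_mem).trans_lt hn

variable [BorelSpace M]

/-- Iteration of `exists_split`. The map preserves total mass, so each remainder keeps the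
proportion `1 - ε`. -/
lemma exists_split_seq (S : MarkovSystem F π Y α lam K) (hR : K * lam / (lam - 1) < R)
    [IsFiniteMeasure ν] (hν : HasLogLipschitzDensity π Y R ν) :
    ∃ νs : ℕ → Measure M, νs 0 = ν ∧ ∀ n, HasLogLipschitzDensity π Y R (νs n) ∧
      νs n univ = ENNReal.ofReal ((1 - splitFraction lam K R) ^ n) * ν univ ∧
      (νs n).map F = νs (n + 1) + (ENNReal.ofReal
        (splitFraction lam K R * (1 - splitFraction lam K R) ^ n) * ν univ) • π := by
  have := S.isProbabilityMeasure
  have hε := splitFraction_pos S.one_lt_lam S.nonneg hR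
  have hε1 := splitFraction_lt_one S.one_lt_lam S.nonneg hR
  set ε := splitFraction lam K R
  let P := {ν : Measure M // IsFiniteMeasure ν ∧ HasLogLipschitzDensity π Y R ν}
  have step : ∀ ν : P, ∃ ν' : P,
      ν.1.map F = ν'.1 + (ENNReal.ofReal ε * ν.1 univ) • π := by
    rintro ⟨ν, hfin, hν⟩
    obtain ⟨ν', hν', h⟩ := S.exists_split hR hν
    refine ⟨⟨ν', ?_, hν'⟩, h⟩
    have hle : ν' ≤ ν.map F := by rw [h]; exact Measure.le_add_right le_rfl
    exact isFiniteMeasure_of_le _ hle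
  choose next hnext using step
  let seq : ℕ → P := fun n => next^[n] ⟨ν, inferInstance, hν⟩
  have hsucc : ∀ n, seq (n + 1) = next (seq n) := fun n => Function.iterate_succ_apply' _ _ _
  have hstep : ∀ n, (seq n).1.map F =
      (seq (n + 1)).1 + (ENNReal.ofReal ε * (seq n).1 univ) • π := fun n => by
    rw [hsucc]; exact hnext _
  have hmass : ∀ n, (seq n).1 univ = ENNReal.ofReal ((1 - ε) ^ n) * ν univ := by
    intro n
    induction n with
    | zero => simp [seq]
    | succ n ih =>
      have h := congrArg (fun μ : Measure M => μ univ) (hstep n)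
      have hfin : (seq n).1 univ ≠ ⊤ := by
        have := (seq n).2.1
        exact measure_ne_top _ _
      simp only [Measure.map_apply S.measurable_map MeasurableSet.univ, preimage_univ,
        Measure.add_apply, Measure.smul_apply, measure_univ, smul_eq_mul, mul_one] at h
      have h2 : (seq n).1 univ = ENNReal.ofReal (1 - ε) * (seq n).1 univ +
          ENNReal.ofReal ε * (seq n).1 univ := by
        rw [← add_mul, ← ENNReal.ofReal_add (by linarith) hε.le]
        simp
      have h3 := (ENNReal.add_left_inj (ENNReal.mul_ne_top ENNReal.ofReal_ne_top hfin)).1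
        (h2.symm.trans h)
      rw [← h3, ih, pow_succ', ENNReal.ofReal_mul (by linarith)]
      ring
  refine ⟨fun n => (seq n).1, rfl, fun n => ⟨(seq n).2.2, hmass n, ?_⟩⟩
  rw [hstep n, hmass n, ENNReal.ofReal_mul hε.le, mul_assoc]

/-- The sum of the successive remainders, suitably normalised, is an invariant measure. -/
lemma exists_invariant (S : MarkovSystem F π Y α lam K) (hR : K * lam / (lam - 1) < R) :
    ∃ μ : Measure M, IsProbabilityMeasure μ ∧ HasLogLipschitzDensity π Y R μ ∧ μ.map F = μ := by
  have := S.isProbabilityMeasure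
  have hR0 : 0 < R := rate_pos S.one_lt_lam S.nonneg hR
  have hε := splitFraction_pos S.one_lt_lam S.nonneg hR
  have hε1 := splitFraction_lt_one S.one_lt_lam S.nonneg hR
  obtain ⟨νs, h0, hνs⟩ := S.exists_split_seq hR (ν := π) (hasLogLipschitzDensity_self hR0.le)
  set ε := splitFraction lam K R
  have hgeo := tsum_ofReal_geometric hε hε1.le
  refine ⟨ENNReal.ofReal ε • Measure.sum νs, ⟨?_⟩, ?_, ?_⟩
  · rw [Measure.smul_apply, Measure.sum_apply _ MeasurableSet.univ, smul_eq_mul,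
      ← ENNReal.tsum_mul_left, ← hgeo]
    refine tsum_congr fun n => ?_
    rw [(hνs n).2.1, measure_univ, mul_one, ENNReal.ofReal_mul hε.le]
  · obtain ⟨g, hg, hH, h⟩ := HasLogLipschitzDensity.sum fun n => (hνs n).1
    refine ⟨fun x => ENNReal.ofReal ε * g x, by fun_prop, hH.const_mul _, ?_⟩
    rw [h, ← withDensity_smul _ hg]
    rfl
  -- Applying `F` shifts the series of remainders by one, and the parts split off add up to `π`,
  -- which is the missing term `νs 0`.
  · rw [Measure.map_smul, Measure.map_sum S.measurable_map.aemeasurable]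
    congr 1
    ext A hA
    rw [Measure.sum_apply _ hA, Measure.sum_apply _ hA,
      tsum_eq_zero_add' (f := fun n => νs n A) ENNReal.summable, h0]
    have : ∀ n, (νs n).map F A = νs (n + 1) A + ENNReal.ofReal (ε * (1 - ε) ^ n) * π A := by
      intro n
      rw [(hνs n).2.2]
      simp
    simp_rw [this]
    rw [ENNReal.tsum_add, ENNReal.tsum_mul_right, hgeo, one_mul, add_comm]

/-! ### Ergodicity of Markov systems -/

lemma measure_mul_le_of_invariant (S : MarkovSystem F π Y α lam K)
    (hR : K * lam / (lam - 1) < R) [IsFiniteMeasure ν] (hν : HasLogLipschitzDensity π Y R ν)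
    {A : Set M} (hA : MeasurableSet A) (hFA : F ⁻¹' A = A) : ν univ * π A ≤ ν A := by
  have hε := splitFraction_pos S.one_lt_lam S.nonneg hR
  have hε1 := splitFraction_lt_one S.one_lt_lam S.nonneg hR
  obtain ⟨νs, h0, hνs⟩ := S.exists_split_seq hR hν
  set ε := splitFraction lam K R
  -- As `A` is invariant, `F` does not change the mass in `A`; in the limit, the part split off at
  -- all stages contributes the full share `ν univ * π A`.
  have hstep : ∀ n, νs n A = νs (n + 1) A +
      ENNReal.ofReal (ε * (1 - ε) ^ n) * ν univ * π A := by
    intro n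
    have := congrArg (fun μ : Measure M => μ A) (hνs n).2.2
    simpa [Measure.map_apply S.measurable_map hA, hFA] using this
  have hsum : ∀ N, ν A = νs N A +
      ∑ n ∈ Finset.range N, ENNReal.ofReal (ε * (1 - ε) ^ n) * ν univ * π A := by
    intro N
    induction N with
    | zero => simp [h0]
    | succ N ih => rw [ih, hstep N, Finset.sum_range_succ]; ring
  have hle : ∑' n, ENNReal.ofReal (ε * (1 - ε) ^ n) * ν univ * π A ≤ ν A :=
    ENNReal.tsum_le_of_sum_range_le fun N => by rw [hsum N]; exact le_add_self
  rwa [ENNReal.tsum_mul_right, ENNReal.tsum_mul_right, tsum_ofReal_geometric hε hε1.le,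
    one_mul] at hle

/-- The density is at least `1`, so its logarithm is Lipschitz with the constant `t L` of the
density itself. -/
lemma hasLogLipschitzDensity_one_add {t : ℝ} {L : ℝ≥0} (ht : 0 ≤ t) (htL : t * L ≤ R)
    {g : M → ℝ≥0} (hg : LipschitzWith L g) :
    HasLogLipschitzDensity π Y R (π.withDensity fun x => 1 + ENNReal.ofReal t * g x) := by
  have hgm : Measurable g := hg.continuous.measurable
  refine ⟨_, by fun_prop, fun x _ y _ => ?_, rfl⟩
  have hconv : ∀ z, 1 + ENNReal.ofReal t * (g z : ℝ≥0∞) = ENNReal.ofReal (1 + t * g z) :=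
    fun z => by
      rw [ENNReal.ofReal_add zero_le_one (by positivity), ENNReal.ofReal_mul ht]
      simp
  simp only [hconv]
  rw [← ENNReal.ofReal_mul (Real.exp_pos _).le]
  apply ENNReal.ofReal_le_ofReal
  have h1 : (g x : ℝ) - g y ≤ L * dist x y :=
    (le_abs_self _).trans (by simpa [NNReal.dist_eq] using hg.dist_le_mul x y)
  have h2 : 1 + R * dist x y ≤ Real.exp (R * dist x y) := by
    linarith [Real.add_one_le_exp (R * dist x y)]
  have h3 : 0 ≤ t * (g y : ℝ) := by positivity
  have h4 : t * ((g x : ℝ) - g y) ≤ R * dist x y :=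
    calc t * ((g x : ℝ) - g y) ≤ t * (L * dist x y) := by gcongr
      _ = t * L * dist x y := by ring
      _ ≤ _ := by gcongr
  have h5 : 0 ≤ R * dist x y := (mul_nonneg (by positivity) dist_nonneg).trans
    (mul_le_mul_of_nonneg_right htL dist_nonneg)
  nlinarith

/-- The inequality `ν univ * π A ≤ ν A` is linear in the density and an equality for the density
`1`. Testing it on `1 + t g` therefore gives it for every bounded Lipschitz `g`, in particular for
approximations of the indicator of `C`. -/
lemma measure_mul_le_inter_of_isClosed (S : MarkovSystem F π Y α lam K)
    {A C : Set M} (hA : MeasurableSet A) (hFA : F ⁻¹' A = A) (hC : IsClosed C) :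
    π C * π A ≤ π (A ∩ C) := by
  have := S.isProbabilityMeasure
  have hR0 : 0 < K * lam / (lam - 1) + 1 :=
    rate_pos S.one_lt_lam S.nonneg (lt_add_one (K * lam / (lam - 1)))
  set R := K * lam / (lam - 1) + 1 with hRdef
  have key : ∀ {δ : ℝ} (hδ : 0 < δ),
      (∫⁻ x, thickenedIndicator hδ C x ∂π) * π A ≤
        ∫⁻ x in A, thickenedIndicator hδ C x ∂π := by
    intro δ hδ
    have hlip := lipschitzWith_thickenedIndicator hδ C
    set g := thickenedIndicator hδ C
    have hgm : Measurable g := hlip.continuous.measurable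
    have hg1 : ∀ x, (g x : ℝ≥0∞) ≤ 1 := fun x => by
      exact_mod_cast thickenedIndicator_le_one hδ C x
    -- The thickened indicator has Lipschitz constant `1 / δ`, so `t = R δ` is admissible.
    have ht : 0 < R * δ := by positivity
    have htL : R * δ * (δ.toNNReal⁻¹ : ℝ≥0) ≤ R := by
      rw [NNReal.coe_inv, Real.coe_toNNReal _ hδ.le]
      field_simp
      rfl
    have hν := hasLogLipschitzDensity_one_add (π := π) (Y := Y) ht.le htL hlip
    have hfinite : IsFiniteMeasure
        (π.withDensity fun x => 1 + ENNReal.ofReal (R * δ) * (g x : ℝ≥0∞)) := by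
      refine isFiniteMeasure_withDensity (ne_top_of_le_ne_top
        (b := ∫⁻ _, 1 + ENNReal.ofReal (R * δ) * 1 ∂π) (by simp) ?_)
      exact lintegral_mono fun x => by gcongr; exact hg1 x
    have h := S.measure_mul_le_of_invariant (lt_add_one _) hν hA hFA
    rw [withDensity_apply _ MeasurableSet.univ, withDensity_apply _ hA, setLIntegral_univ,
      lintegral_add_left measurable_const, lintegral_add_left measurable_const,
      lintegral_const_mul _ (by fun_prop), lintegral_const_mul _ (by fun_prop), add_mul] at h
    simp only [lintegral_const, measure_univ, mul_one, one_mul, Measure.restrict_apply_univ] at h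
    rw [ENNReal.add_le_add_iff_left (measure_ne_top _ _), mul_assoc] at h
    exact (ENNReal.mul_le_mul_iff_right (by simpa using ht) ENNReal.ofReal_ne_top).1 h
  have hpos : ∀ n : ℕ, 0 < 1 / ((n : ℝ) + 1) := fun n => Nat.one_div_pos_of_nat
  have hlim := tendsto_one_div_add_atTop_nhds_zero_nat (𝕜 := ℝ)
  have t1 := tendsto_lintegral_thickenedIndicator_of_isClosed π hC hpos hlim
  have t2 := tendsto_lintegral_thickenedIndicator_of_isClosed (π.restrict A) hC hpos hlim
  rw [Measure.restrict_apply hC.measurableSet, inter_comm] at t2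
  exact le_of_tendsto_of_tendsto' (ENNReal.Tendsto.mul_const t1 (Or.inr (measure_ne_top _ _))) t2
    fun n => key (hpos n)

/-- If `A` is invariant and not null, every closed subset of its complement is null by the previous
inequality, and inner regularity gives the complement itself. -/
lemma ergodic (S : MarkovSystem F π Y α lam K) (hinv : π.map F = π) : Ergodic F π := by
  have := S.isProbabilityMeasure
  refine ⟨⟨S.measurable_map, hinv⟩, ⟨fun A hA hFA => ?_⟩⟩
  rw [Filter.eventuallyConst_set']
  by_cases h0 : π A = 0
  · exact Or.inl (ae_eq_empty.2 h0)
  refine Or.inr (ae_eq_univ.2 ?_)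
  rw [hA.compl.measure_eq_iSup_isClosed_of_ne_top (measure_ne_top _ _)]
  simp only [ENNReal.iSup_eq_zero]
  intro C hCA hC
  have h := S.measure_mul_le_inter_of_isClosed hA hFA hC
  rw [(disjoint_left.2 fun x hx hxC => hCA hxC hx : Disjoint A C).inter_eq, measure_empty, nonpos_iff_eq_zero, mul_eq_zero] at h
  exact h.resolve_right h0

end MarkovSystem

/-! ### Stopping weights -/

section Stopping

/-- The weight stopped after `n` further steps along the orbit of `y`, from the stage `j` on, if the
fraction `a i y` of the mass at `y` is kept at the stage `i`. -/
noncomputable def stopWeight {M : Type*} (F : M → M) (a : ℕ → M → ℝ≥0∞) : ℕ → ℕ → M → ℝ≥0∞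
  | 0, j => fun y => 1 - a j y
  | n + 1, j => fun y => a j y * stopWeight F a n (j + 1) (F y)

lemma sum_stopWeight_le {M : Type*} {F : M → M} {a : ℕ → M → ℝ≥0∞}
    (ha : ∀ j y, a j y ≤ 1) (N j : ℕ) (y : M) :
    ∑ n ∈ Finset.range N, stopWeight F a n j y ≤ 1 := by
  induction N generalizing j y with
  | zero => simp
  | succ N ih =>
    rw [Finset.sum_range_succ']
    simp only [stopWeight]
    rw [← Finset.mul_sum]
    calc a j y * ∑ n ∈ Finset.range N, stopWeight F a n (j + 1) (F y) + (1 - a j y)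
        ≤ a j y * 1 + (1 - a j y) := by gcongr; exact ih _ _
      _ = 1 := by rw [mul_one, add_tsub_cancel_of_le (ha j y)]

variable {M : Type*} [MeasurableSpace M] {F : M → M} {a : ℕ → M → ℝ≥0∞} {νs : ℕ → Measure M} {μ : Measure M} {c : ℕ → ℝ≥0∞}

lemma measurable_stopWeight (hF : Measurable F) (ha : ∀ j, Measurable (a j)) (n j : ℕ) :
    Measurable (stopWeight F a n j) := by
  induction n generalizing j with
  | zero => exact measurable_const.sub (ha j)
  | succ n ih => exact (ha j).mul ((ih (j + 1)).comp hF)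

lemma lintegral_comp_of_map_withDensity {ν ν' : Measure M} {b : M → ℝ≥0∞} (hF : Measurable F)
    (hb : Measurable b) (h : (ν.map F).withDensity b = ν') {H : M → ℝ≥0∞} (hH : Measurable H) :
    ∫⁻ x, b (F x) * H (F x) ∂ν = ∫⁻ y, H y ∂ν' := by
  rw [← h, lintegral_withDensity_eq_lintegral_mul _ hb hH, lintegral_map (hb.mul hH) hF]
  rfl

/-- Weights are evaluated at `F x` because `a j` is a density relative to the image of `νs j`. One
kept step turns that image into `νs (j + 1)`; after `n` of them the stopped part is `c (j + n) • μ`.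
-/
lemma lintegral_stopWeight (hF : Measurable F) (ha : ∀ j, Measurable (a j))
    (hA : ∀ j, ((νs j).map F).withDensity (a j) = νs (j + 1))
    (hB : ∀ j, ((νs j).map F).withDensity (fun y => 1 - a j y) = c j • μ)
    {G : M → ℝ≥0∞} (hG : Measurable G) (n j : ℕ) :
    ∫⁻ x, stopWeight F a n j (F x) * G (F^[n] (F x)) ∂(νs j) = c (j + n) * ∫⁻ y, G y ∂μ := by
  induction n generalizing j with
  | zero =>
    have := lintegral_comp_of_map_withDensity hF (measurable_const.sub (ha j)) (hB j) hG
    simpa [stopWeight] using this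
  | succ n ih =>
    have h := lintegral_comp_of_map_withDensity hF (ha j) (hA j)
      (H := fun y => stopWeight F a n (j + 1) (F y) * G (F^[n] (F y)))
      (((measurable_stopWeight hF ha n (j + 1)).comp hF).mul
        (hG.comp ((hF.iterate n).comp hF)))
    rw [ih, add_assoc, add_comm 1 n] at h
    simpa [stopWeight, mul_assoc] using h

/-- Peeling off `i` kept steps moves the factor `f` to the current time, where `hD` separates it
from the stopping weight, a function of the image point. The condition `i ≤ n` says that stopping
occurs later. -/
lemma lintegral_iterate_mul_stopWeight_le (hF : Measurable F) (ha : ∀ j, Measurable (a j))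
    (hA : ∀ j, ((νs j).map F).withDensity (a j) = νs (j + 1))
    (hB : ∀ j, ((νs j).map F).withDensity (fun y => 1 - a j y) = c j • μ) (hμ : μ univ = 1)
    {f : M → ℝ≥0∞} (hf : Measurable f) {C : ℝ≥0∞}
    (hD : ∀ j (H : M → ℝ≥0∞), Measurable H →
      ∫⁻ x, f x * H (F x) ∂(νs j) ≤ C * ∫⁻ x, H (F x) ∂(νs j))
    (i n j : ℕ) (hin : i ≤ n) :
    ∫⁻ x, f (F^[i] x) * stopWeight F a n j (F x) ∂(νs j) ≤ C * c (j + n) := by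
  induction i generalizing n j with
  | zero =>
    refine (hD j _ (measurable_stopWeight hF ha n j)).trans (le_of_eq ?_)
    have := lintegral_stopWeight hF ha hA hB (G := fun _ => 1) measurable_const n j
    simp only [mul_one, lintegral_one, hμ] at this
    rw [this]
  | succ i ih =>
    obtain ⟨n, rfl⟩ := Nat.exists_eq_add_of_le' (Nat.one_le_of_lt hin)
    have h := lintegral_comp_of_map_withDensity hF (ha j) (hA j)
      (H := fun y => f (F^[i] y) * stopWeight F a n (j + 1) (F y))
      ((hf.comp (hF.iterate i)).mul ((measurable_stopWeight hF ha n (j + 1)).comp hF))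
    have h2 := ih n (j + 1) (by omega)
    rw [← h, add_assoc, add_comm 1 n] at h2
    refine le_trans (le_of_eq (lintegral_congr fun x => ?_)) h2
    simp only [stopWeight, Function.iterate_succ_apply]
    ring

/-- The remaining factors and the stopping weight depend on the image point only, so `hD` extracts
one factor `C` at each step. -/
lemma lintegral_prod_iterate_mul_stopWeight_le (hF : Measurable F) (ha : ∀ j, Measurable (a j))
    (hA : ∀ j, ((νs j).map F).withDensity (a j) = νs (j + 1))
    (hB : ∀ j, ((νs j).map F).withDensity (fun y => 1 - a j y) = c j • μ) (hμ : μ univ = 1)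
    {f : M → ℝ≥0∞} (hf : Measurable f) {C : ℝ≥0∞}
    (hD : ∀ j (H : M → ℝ≥0∞), Measurable H →
      ∫⁻ x, f x * H (F x) ∂(νs j) ≤ C * ∫⁻ x, H (F x) ∂(νs j))
    (n j : ℕ) :
    ∫⁻ x, (∏ i ∈ Finset.range (n + 1), f (F^[i] x)) * stopWeight F a n j (F x) ∂(νs j) ≤
      C ^ (n + 1) * c (j + n) := by
  induction n generalizing j with
  | zero =>
    simpa using lintegral_iterate_mul_stopWeight_le hF ha hA hB hμ hf hD 0 0 j le_rfl
  | succ n ih =>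
    have hm : ∀ m, Measurable fun y => ∏ i ∈ Finset.range m, f (F^[i] y) := fun m =>
      Finset.measurable_prod _ fun i _ => hf.comp (hF.iterate i)
    have h := lintegral_comp_of_map_withDensity hF (ha j) (hA j)
      (H := fun y => (∏ i ∈ Finset.range (n + 1), f (F^[i] y)) * stopWeight F a n (j + 1) (F y))
      ((hm _).mul ((measurable_stopWeight hF ha n (j + 1)).comp hF))
    have h2 := ih (j + 1)
    rw [← h, add_assoc, add_comm 1 n] at h2
    have h3 := hD j (fun y => a j y * ((∏ i ∈ Finset.range (n + 1), f (F^[i] y)) *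
      stopWeight F a n (j + 1) (F y)))
      ((ha j).mul ((hm _).mul ((measurable_stopWeight hF ha n (j + 1)).comp hF)))
    rw [pow_succ', mul_assoc]
    refine le_trans (le_of_eq (lintegral_congr fun x => ?_)) (h3.trans (by gcongr))
    rw [Finset.prod_range_succ']
    simp only [stopWeight, Function.iterate_succ_apply, Function.iterate_zero, id_eq]
    ring

end Stopping

lemma exists_kept_fraction {X : Type*} [MeasurableSpace X] {ν ν' μ : Measure X}
    [IsFiniteMeasure ν] (h : ν = ν' + μ) :
    ∃ a : X → ℝ≥0∞, Measurable a ∧ (∀ x, a x ≤ 1) ∧ ν.withDensity a = ν' ∧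
      ν.withDensity (fun x => 1 - a x) = μ := by
  have hle : ν' ≤ ν := by rw [h]; exact Measure.le_add_right le_rfl
  have := isFiniteMeasure_of_le ν hle
  have hac : ν' ≪ ν := Measure.absolutelyContinuous_of_le hle
  -- The derivative is at most `1` almost everywhere only; the truncation gives the bound at every
  -- point.
  have hm : Measurable fun x => min 1 (ν'.rnDeriv ν x) :=
    measurable_const.min (Measure.measurable_rnDeriv _ _)
  have h1 : ν.withDensity (fun x => min 1 (ν'.rnDeriv ν x)) = ν' := by
    refine (withDensity_congr_ae ?_).trans (Measure.withDensity_rnDeriv_eq ν' ν hac)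
    filter_upwards [Measure.rnDeriv_le_one_of_le hle] with x hx
    exact min_eq_right hx
  refine ⟨_, hm, fun x => min_le_left _ _, h1, ?_⟩
  rw [← Measure.add_right_inj ν', ← h]
  nth_rewrite 1 [← h1]
  rw [← withDensity_add_left hm]
  conv_rhs => rw [← withDensity_one (μ := ν)]
  congr 1
  ext x
  exact add_tsub_cancel_of_le (min_le_left _ _)

namespace MarkovSystem

variable {M : Type*} [MetricSpace M] [MeasurableSpace M] [BorelSpace M] {F : M → M}
  {μ ν : Measure M} {Y : Set M} {α : Set (Set M)} {lam K R : ℝ}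

/-- Mass of a measure with log-Lipschitz density can be stopped, at a geometric number of steps of
`F`, in such a way that the stopped mass is distributed as the reference measure. -/
lemma exists_stopping (S : MarkovSystem F μ Y α lam K) (hR : K * lam / (lam - 1) < R)
    [IsFiniteMeasure ν] (hν : HasLogLipschitzDensity μ Y R ν) :
    ∃ W : ℕ → M → ℝ≥0∞, (∀ n, Measurable (W n)) ∧ (∀ᵐ x ∂ν, ∑' n, W n x = 1) ∧
      (∀ n (G : M → ℝ≥0∞), Measurable G → ∫⁻ x, W n x * G (F^[n + 1] x) ∂ν =
        ENNReal.ofReal (splitFraction lam K R * (1 - splitFraction lam K R) ^ n) * ν univ *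
          ∫⁻ y, G y ∂μ) ∧
      (∀ f : M → ℝ≥0∞, Measurable f → (∀ a ∈ α, ∃ c, ∀ x ∈ a, f x = c) →
        (∀ n, ∀ i ≤ n, ∫⁻ x, f (F^[i] x) * W n x ∂ν ≤
          ENNReal.ofReal (Real.exp (3 * R)) * (∫⁻ x, f x ∂μ) * (ENNReal.ofReal
            (splitFraction lam K R * (1 - splitFraction lam K R) ^ n) * ν univ)) ∧
        ∀ n, ∫⁻ x, (∏ i ∈ Finset.range (n + 1), (1 + f (F^[i] x))) * W n x ∂ν ≤
          (1 + ENNReal.ofReal (Real.exp (3 * R)) * ∫⁻ x, f x ∂μ) ^ (n + 1) * (ENNReal.ofReal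
            (splitFraction lam K R * (1 - splitFraction lam K R) ^ n) * ν univ)) := by
  have := S.isProbabilityMeasure
  have hε := splitFraction_pos S.one_lt_lam S.nonneg hR
  have hε1 := splitFraction_lt_one S.one_lt_lam S.nonneg hR
  obtain ⟨νs, h0, hνs⟩ := S.exists_split_seq hR hν
  set ε := splitFraction lam K R
  have hfin : ∀ j, IsFiniteMeasure (νs j) := fun j => ⟨by
    rw [(hνs j).2.1]; exact ENNReal.mul_lt_top ENNReal.ofReal_lt_top (measure_lt_top _ _)⟩
  choose a ha ha1 hA hB using fun j => exists_kept_fraction (hνs j).2.2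
  have hF := S.measurable_map
  set c : ℕ → ℝ≥0∞ := fun n => ENNReal.ofReal (ε * (1 - ε) ^ n) * ν univ
  have hW : ∀ n, Measurable fun x => stopWeight F a n 0 (F x) := fun n =>
    (measurable_stopWeight hF ha n 0).comp hF
  have hmass := fun (G : M → ℝ≥0∞) hG n => lintegral_stopWeight hF ha hA hB (G := G) hG n 0
  simp only [h0, zero_add] at hmass
  refine ⟨fun n x => stopWeight F a n 0 (F x), hW, ?_, fun n G hG => hmass G hG n,
    fun f hf hfα => ⟨fun n i hin => ?_, fun n => ?_⟩⟩
  · have hle : ∀ x, ∑' n, stopWeight F a n 0 (F x) ≤ 1 := fun x =>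
      ENNReal.tsum_le_of_sum_range_le fun N => sum_stopWeight_le ha1 N 0 (F x)
    have hint : ∫⁻ x, ∑' n, stopWeight F a n 0 (F x) ∂ν = ν univ := by
      rw [lintegral_tsum fun n => (hW n).aemeasurable]
      have : ∀ n, ∫⁻ x, stopWeight F a n 0 (F x) ∂ν = c n := fun n => by
        simpa using hmass (fun _ => 1) measurable_const n
      simp_rw [this, c]
      rw [ENNReal.tsum_mul_right, tsum_ofReal_geometric hε hε1.le, one_mul]
    -- The weights add up to at most `1` everywhere and have total integral `ν univ`, since the
    -- geometric probabilities add up to `1`.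
    refine ae_eq_of_ae_le_of_lintegral_le (g := fun _ => 1) (Filter.Eventually.of_forall hle) ?_
      aemeasurable_const ?_
    · rw [hint]; exact measure_ne_top _ _
    · rw [hint]; simp
  -- The bound on a single factor uses the stage `0` of the splitting, where the remainder is `ν`.
  · have := lintegral_iterate_mul_stopWeight_le hF ha hA hB measure_univ hf
      (fun j H hH => S.lintegral_mul_comp_le hR (hνs j).1 hfα hH) i n 0 hin
    simpa only [h0, zero_add] using this
  · have := lintegral_prod_iterate_mul_stopWeight_le hF ha hA hB measure_univ
      (f := fun x => 1 + f x) (measurable_const.add hf)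
      (C := 1 + ENNReal.ofReal (Real.exp (3 * R)) * ∫⁻ x, f x ∂μ) (fun j H hH => ?_) n 0
    · simpa only [h0, zero_add] using this
    · simp_rw [add_mul, one_mul]
      rw [lintegral_add_left (show Measurable fun x => H (F x) from hH.comp hF)]
      gcongr
      exact S.lintegral_mul_comp_le hR (hνs j).1 hfα hH

end MarkovSystem

/-! ### The coupling -/

lemma iterate_inducedMap {M : Type*} (T : M → M) (τ : M → ℕ) (n : ℕ) (y : M) :
    (inducedMap T τ)^[n] y =
      T^[∑ i ∈ Finset.range n, τ ((inducedMap T τ)^[i] y)] y := by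
  induction n with
  | zero => simp
  | succ n ih =>
    rw [Function.iterate_succ_apply', Finset.sum_range_succ, add_comm, Function.iterate_add_apply,
      ← ih]
    rfl

/-- On a separable set, the diagonal is measurable for the product `σ`-algebra. -/
lemma exists_measurableSet_subset_diagonal {M : Type*} [MetricSpace M] [MeasurableSpace M]
    [BorelSpace M] {Q : Set M} (hQ : Q.Countable) :
    ∃ D : Set (M × M), MeasurableSet D ∧ (∀ p ∈ D, p.1 = p.2) ∧ ∀ y ∈ closure Q, (y, y) ∈ D := by
  refine ⟨⋂ n : ℕ, ⋃ q ∈ Q, Metric.ball q (1 / ((n : ℝ) + 1)) ×ˢ Metric.ball q (1 / ((n : ℝ) + 1)),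
    ?_, ?_, ?_⟩
  · exact MeasurableSet.iInter fun n => MeasurableSet.biUnion hQ fun q _ =>
      measurableSet_ball.prod measurableSet_ball
  · rintro ⟨x, y⟩ hp
    refine eq_of_forall_dist_le fun ε hε => ?_
    obtain ⟨n, hn⟩ := exists_nat_one_div_lt (half_pos hε)
    obtain ⟨q, -, hxq, hyq⟩ := mem_iUnion₂.1 (mem_iInter.1 hp n)
    have := dist_triangle_right x y q
    simp only [Metric.mem_ball] at hxq hyq
    linarith
  · intro y hy
    refine mem_iInter.2 fun n => ?_
    obtain ⟨q, hq, hd⟩ := Metric.mem_closure_iff.1 hy _ (Nat.one_div_pos_of_nat (n := n) (α := ℝ))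
    exact mem_iUnion₂.2 ⟨q, hq, hd, hd⟩

open Classical in
/-- A measurable upper bound of the merging time, where `D` is a subset of the diagonal. -/
noncomputable def mergingBound {M : Type*} (T : M → M) (D : Set (M × M)) (p : M × M) : ℝ≥0∞ :=
  -- Only mergings of the form `T^j x = y` are counted: in the coupling the second point lies on the
  -- orbit of the first.
  ⨅ j : ℕ, if (T^[j] p.1, p.2) ∈ D then (j : ℝ≥0∞) else ⊤

section MergingBound

variable {M : Type*} {T : M → M} {D : Set (M × M)}

lemma measurable_mergingBound [MeasurableSpace M] (hT : Measurable T) (hD : MeasurableSet D) :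
    Measurable (mergingBound T D) := by
  refine Measurable.iInf fun j => Measurable.ite ?_ measurable_const measurable_const
  exact (((hT.iterate j).comp measurable_fst).prodMk measurable_snd) hD

lemma mergingTime_le_mergingBound (hD : ∀ p ∈ D, p.1 = p.2) (p : M × M) :
    (mergingTime T p : ℝ≥0∞) ≤ mergingBound T D p := by
  refine le_iInf fun j => ?_
  split_ifs with h
  · have h1 : mergingTime T p ≤ j :=
      (iInf₂_le j 0).trans ((iInf_le _ (hD _ h)).trans (by simp))
    exact_mod_cast ENat.toENNReal_mono h1
  · exact le_top

lemma mergingBound_le {x y : M} {j : ℕ} (h : T^[j] x = y) (hy : (y, y) ∈ D) :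
    mergingBound T D (x, y) ≤ j :=
  (iInf_le _ j).trans (by simp [h, hy])

end MergingBound

/-- Couple `ρ = ∑ k, ρs k` with `μ`, where `T^k` maps `ρs k` to a measure with log-Lipschitz density
with respect to `μ`. The merging time is controlled through the geometric stopping. -/
lemma exists_coupling {M : Type*} [MetricSpace M] [MeasurableSpace M] [BorelSpace M] {T : M → M}
    {τ : M → ℕ} {μ : Measure M} {Y : Set M} {α : Set (Set M)} {lam K R : ℝ} (hT : Measurable T)
    (hτ : Measurable τ) (hτα : ∀ a ∈ α, ∃ k, ∀ x ∈ a, τ x = k)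
    (S : MarkovSystem (inducedMap T τ) μ Y α lam K)
    (hR : K * lam / (lam - 1) < R) (ρs : ℕ → Measure M)
    [IsProbabilityMeasure (Measure.sum ρs)]
    (hρs : ∀ k, HasLogLipschitzDensity μ Y R ((ρs k).map T^[k])) :
    ∃ (ρhat : Measure (M × M)) (g : M × M → ℝ≥0∞),
      ρhat.map Prod.fst = Measure.sum ρs ∧ ρhat.map Prod.snd = μ ∧
      Measurable g ∧ (∀ p, (mergingTime T p : ℝ≥0∞) ≤ g p) ∧
      -- Additive form, for polynomial tails and moments; `n + 1` is the number of returns before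
      -- stopping.
      (∀ (h : ℝ≥0∞ → ℝ≥0∞) (f : ℕ → ℕ → ℝ≥0∞), Monotone h →
        (∀ (n k : ℕ) (t : ℕ → ℕ), h ((k + ∑ i ∈ Finset.range (n + 1), t i : ℕ) : ℝ≥0∞) ≤
          f n k + ∑ i ∈ Finset.range (n + 1), f n (t i)) →
        ∫⁻ p, h (g p) ∂ρhat ≤ ∑' n, ENNReal.ofReal
          (splitFraction lam K R * (1 - splitFraction lam K R) ^ n) *
            ((∑' k, f n k * ρs k univ) +
              (n + 1) * (ENNReal.ofReal (Real.exp (3 * R)) * ∫⁻ y, f n (τ y) ∂μ))) ∧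
      -- Multiplicative form, for exponential moments.
      (∀ (h : ℝ≥0∞ → ℝ≥0∞) (c : ℝ≥0∞) (f₀ f : ℕ → ℝ≥0∞), Monotone h →
        (∀ (n k : ℕ) (t : ℕ → ℕ), h ((k + ∑ i ∈ Finset.range (n + 1), t i : ℕ) : ℝ≥0∞) ≤
          c * f₀ k * ∏ i ∈ Finset.range (n + 1), (1 + f (t i))) →
        ∫⁻ p, h (g p) ∂ρhat ≤ c * (∑' k, f₀ k * ρs k univ) * ∑' n, ENNReal.ofReal
          (splitFraction lam K R * (1 - splitFraction lam K R) ^ n) *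
            (1 + ENNReal.ofReal (Real.exp (3 * R)) * ∫⁻ y, f (τ y) ∂μ) ^ (n + 1)) := by
  have := S.isProbabilityMeasure
  have hε := splitFraction_pos S.one_lt_lam S.nonneg hR
  have hε1 := splitFraction_lt_one S.one_lt_lam S.nonneg hR
  have hfin : ∀ k, IsFiniteMeasure (ρs k) := fun k =>
    isFiniteMeasure_of_le _ (Measure.le_sum ρs k)
  have hmap_univ : ∀ k, (ρs k).map T^[k] univ = ρs k univ := fun k => by
    rw [Measure.map_apply (hT.iterate k) MeasurableSet.univ, preimage_univ]
  have hmass : ∑' k, ρs k univ = 1 := by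
    rw [← Measure.sum_apply _ MeasurableSet.univ, measure_univ]
  choose W hWm hW1 hWμ hWf using fun k => S.exists_stopping hR (hρs k)
  obtain ⟨Q, hQ, hQae⟩ := S.exists_countable_ae_mem_closure
  obtain ⟨D, hDm, hD, hDQ⟩ := exists_measurableSet_subset_diagonal hQ
  have hF : Measurable (inducedMap T τ) := S.measurable_map
  set F := inducedMap T τ with hFdef
  set ε := splitFraction lam K R
  have hpair : ∀ kn : ℕ × ℕ, Measurable fun x => (x, F^[kn.2 + 1] (T^[kn.1] x)) := fun kn =>
    measurable_id.prodMk ((hF.iterate _).comp (hT.iterate _))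
  have hWT : ∀ k n, Measurable fun x => W k n (T^[k] x) := fun k n =>
    (hWm k n).comp (hT.iterate k)
  -- The piece `(k, n)` pairs `x` with the point at which its orbit is stopped, weighted by the
  -- share of the mass at `x` stopped there.
  set ρhat : Measure (M × M) := Measure.sum fun kn : ℕ × ℕ =>
    ((ρs kn.1).withDensity fun x => W kn.1 kn.2 (T^[kn.1] x)).map
      fun x => (x, F^[kn.2 + 1] (T^[kn.1] x)) with hρhat
  have hint : ∀ Φ : M × M → ℝ≥0∞, Measurable Φ → ∫⁻ p, Φ p ∂ρhat =
      ∑' (k) (n), ∫⁻ x, W k n (T^[k] x) * Φ (x, F^[n + 1] (T^[k] x)) ∂(ρs k) := by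
    intro Φ hΦ
    rw [hρhat, lintegral_sum_measure, ENNReal.tsum_prod']
    refine tsum_congr fun k => tsum_congr fun n => ?_
    rw [lintegral_map hΦ (hpair (k, n)), lintegral_withDensity_eq_lintegral_mul _ (hWT k n)
      (show Measurable fun x => Φ (x, F^[n + 1] (T^[k] x)) from hΦ.comp (hpair (k, n)))]
    rfl
  have hpush : ∀ k (Ψ : M → ℝ≥0∞), Measurable Ψ →
      ∫⁻ x, Ψ (T^[k] x) ∂(ρs k) = ∫⁻ y, Ψ y ∂((ρs k).map T^[k]) := fun k Ψ hΨ =>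
    (lintegral_map hΨ (hT.iterate k)).symm
  -- Almost every stopped point lies in the separable set on which `D` contains the diagonal.
  have hsep : ∀ k, ∀ᵐ x ∂(ρs k), ∀ n, F^[n] (T^[k] x) ∈ closure Q := by
    intro k
    have h1 : ∀ n, ∀ᵐ y ∂μ, F^[n] y ∈ closure Q := fun n => by
      induction n with
      | zero => exact hQae
      | succ n ih => exact S.ae_map_mem ih
    have hac : (ρs k).map T^[k] ≪ μ := by
      obtain ⟨φ, -, -, hφ⟩ := hρs k
      rw [hφ]
      exact withDensity_absolutelyContinuous _ _
    exact ae_of_ae_map (hT.iterate k).aemeasurable (hac.ae_le (ae_all_iff.2 h1))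
  have hbound : ∀ h : ℝ≥0∞ → ℝ≥0∞, Monotone h → ∀ B : ℕ → ℕ → M → ℝ≥0∞,
      (∀ k n, Measurable (B k n)) →
      (∀ k n y, h ((k + ∑ i ∈ Finset.range (n + 1), τ (F^[i] y) : ℕ) : ℝ≥0∞) ≤ B k n y) →
      ∫⁻ p, h (mergingBound T D p) ∂ρhat ≤
        ∑' (k) (n), ∫⁻ y, W k n y * B k n y ∂((ρs k).map T^[k]) := by
    intro h hh B hBm hB
    rw [hint (fun p => h (mergingBound T D p))
      (hh.measurable.comp (measurable_mergingBound hT hDm))]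
    refine ENNReal.tsum_le_tsum fun k => ENNReal.tsum_le_tsum fun n => ?_
    rw [← hpush k (fun y => W k n y * B k n y) ((hWm k n).mul (hBm k n))]
    refine lintegral_mono_ae ((hsep k).mono fun x hx => ?_)
    refine mul_le_mul_right ((hh ?_).trans (hB k n _)) _
    refine mergingBound_le ?_ (hDQ _ (hx (n + 1)))
    rw [add_comm, Function.iterate_add_apply, hFdef, ← iterate_inducedMap]
  refine ⟨ρhat, mergingBound T D, ?_, ?_, measurable_mergingBound hT hDm,
    mergingTime_le_mergingBound hD, ?_, ?_⟩
  · ext A hA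
    rw [Measure.map_apply measurable_fst hA, ← lintegral_indicator_one (measurable_fst hA),
      hint _ (measurable_one.indicator (measurable_fst hA)), Measure.sum_apply _ hA]
    refine tsum_congr fun k => ?_
    have hm : ∀ n, Measurable fun x => W k n (T^[k] x) *
        (Prod.fst ⁻¹' A).indicator (1 : M × M → ℝ≥0∞) (x, F^[n + 1] (T^[k] x)) := fun n =>
      (hWT k n).mul ((measurable_one.indicator (measurable_fst hA)).comp (hpair (k, n)))
    rw [← lintegral_tsum fun n => (hm n).aemeasurable, ← lintegral_indicator_one hA]
    refine lintegral_congr_ae ?_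
    -- First marginal: the weights at almost every point add up to `1`.
    filter_upwards [ae_of_ae_map (hT.iterate k).aemeasurable (hW1 k)] with x hx
    have : ∀ n, (Prod.fst ⁻¹' A).indicator (1 : M × M → ℝ≥0∞) (x, F^[n + 1] (T^[k] x)) =
        A.indicator 1 x := fun n => rfl
    simp only [this]
    rw [ENNReal.tsum_mul_right, hx, one_mul]
  · ext A hA
    rw [Measure.map_apply measurable_snd hA, ← lintegral_indicator_one (measurable_snd hA),
      hint _ (measurable_one.indicator (measurable_snd hA))]
    -- Second marginal: every piece is a multiple of `μ`, and the coefficients add up to `1`.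
    have : ∀ k n, ∫⁻ x, W k n (T^[k] x) * (Prod.snd ⁻¹' A).indicator (1 : M × M → ℝ≥0∞)
        (x, F^[n + 1] (T^[k] x)) ∂(ρs k) =
        ENNReal.ofReal (ε * (1 - ε) ^ n) * (ρs k univ * μ A) := by
      intro k n
      have h1 := hWμ k n (A.indicator 1) (measurable_one.indicator hA)
      rw [← hpush k (fun y => W k n y * A.indicator 1 (F^[n + 1] y))
          ((hWm k n).mul ((measurable_one.indicator hA).comp (hF.iterate _))),
        lintegral_indicator_one hA, hmap_univ, mul_assoc] at h1
      exact h1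
    simp_rw [this]
    simp_rw [ENNReal.tsum_mul_right, tsum_ofReal_geometric hε hε1.le, one_mul]
    rw [ENNReal.tsum_mul_right, hmass, one_mul]
  · intro h f hh hf
    have hfm : ∀ n, Measurable fun y => f n (τ y) := fun n => (measurable_from_nat).comp hτ
    have hfα : ∀ n, ∀ a ∈ α, ∃ c, ∀ x ∈ a, f n (τ x) = c := fun n a ha => by
      obtain ⟨k, hk⟩ := hτα a ha
      exact ⟨f n k, fun x hx => by rw [hk x hx]⟩
    refine (hbound h hh (fun k n y => f n k + ∑ i ∈ Finset.range (n + 1), f n (τ (F^[i] y)))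
      (fun k n => measurable_const.add (Finset.measurable_sum _ fun i _ =>
        (hfm n).comp (hF.iterate i))) (fun k n y => hf n k _)).trans ?_
    have hkn : ∀ k n, ∫⁻ y, W k n y * (f n k + ∑ i ∈ Finset.range (n + 1), f n (τ (F^[i] y)))
        ∂((ρs k).map T^[k]) ≤ ENNReal.ofReal (ε * (1 - ε) ^ n) * (f n k * ρs k univ + (n + 1) *
          (ENNReal.ofReal (Real.exp (3 * R)) * ∫⁻ y, f n (τ y) ∂μ) * ρs k univ) := by
      intro k n
      have h1 : ∫⁻ y, W k n y ∂((ρs k).map T^[k]) =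
          ENNReal.ofReal (ε * (1 - ε) ^ n) * ρs k univ := by
        simpa [hmap_univ] using hWμ k n (fun _ => 1) measurable_const
      have h2 := (hWf k (fun y => f n (τ y)) (hfm n) (hfα n)).1 n
      simp_rw [mul_add, Finset.mul_sum]
      rw [lintegral_add_left ((hWm k n).mul_const _), lintegral_mul_const _ (hWm k n), h1,
        lintegral_finsetSum _ fun i _ =>
          (show Measurable fun y => W k n y * f n (τ (F^[i] y)) from
            (hWm k n).mul ((hfm n).comp (hF.iterate i)))]
      have h3 : ∑ i ∈ Finset.range (n + 1), ∫⁻ y, W k n y * f n (τ (F^[i] y))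
          ∂((ρs k).map T^[k]) ≤ ∑ i ∈ Finset.range (n + 1),
          ENNReal.ofReal (Real.exp (3 * R)) * (∫⁻ x, f n (τ x) ∂μ) *
            (ENNReal.ofReal (ε * (1 - ε) ^ n) * ρs k univ) := by
        refine Finset.sum_le_sum fun i hi => ?_
        have := h2 i (Nat.lt_succ_iff.1 (Finset.mem_range.1 hi))
        simp only [hmap_univ] at this
        simpa only [mul_comm (W k n _)] using this
      refine (add_le_add_right h3 _).trans (le_of_eq ?_)
      rw [Finset.sum_const, Finset.card_range, nsmul_eq_mul]
      push_cast
      ring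
    refine (ENNReal.tsum_le_tsum fun k => ENNReal.tsum_le_tsum fun n => hkn k n).trans ?_
    rw [ENNReal.tsum_comm]
    refine ENNReal.tsum_le_tsum fun n => ?_
    rw [ENNReal.tsum_mul_left, ENNReal.tsum_add, ENNReal.tsum_mul_left, hmass, mul_one]
  · intro h c f₀ f hh hf
    have hfm : Measurable fun y => f (τ y) := (measurable_from_nat).comp hτ
    have hfα : ∀ a ∈ α, ∃ c, ∀ x ∈ a, f (τ x) = c := fun a ha => by
      obtain ⟨k, hk⟩ := hτα a ha
      exact ⟨f k, fun x hx => by rw [hk x hx]⟩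
    have hprod : ∀ n, Measurable fun y => ∏ i ∈ Finset.range (n + 1), (1 + f (τ (F^[i] y))) :=
      fun n => Finset.measurable_prod _ fun i _ => measurable_const.add (hfm.comp (hF.iterate i))
    refine (hbound h hh (fun k n y => c * f₀ k * ∏ i ∈ Finset.range (n + 1), (1 + f (τ (F^[i] y))))
      (fun k n => (hprod n).const_mul _) (fun k n y => hf n k _)).trans ?_
    have hkn : ∀ k n, ∫⁻ y, W k n y * (c * f₀ k *
        ∏ i ∈ Finset.range (n + 1), (1 + f (τ (F^[i] y)))) ∂((ρs k).map T^[k]) ≤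
        c * (f₀ k * ρs k univ) * (ENNReal.ofReal (ε * (1 - ε) ^ n) *
          (1 + ENNReal.ofReal (Real.exp (3 * R)) * ∫⁻ y, f (τ y) ∂μ) ^ (n + 1)) := by
      intro k n
      have h2 := (hWf k (fun y => f (τ y)) hfm hfα).2 n
      rw [hmap_univ] at h2
      calc _ = c * f₀ k * ∫⁻ y, (∏ i ∈ Finset.range (n + 1), (1 + f (τ (F^[i] y)))) * W k n y
            ∂((ρs k).map T^[k]) := by
            rw [← lintegral_const_mul _ (show Measurable fun y =>
              (∏ i ∈ Finset.range (n + 1), (1 + f (τ (F^[i] y)))) * W k n y from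
              (hprod n).mul (hWm k n))]
            exact lintegral_congr fun y => by ring
        _ ≤ _ := mul_le_mul_right h2 _
        _ = _ := by ring
    refine (ENNReal.tsum_le_tsum fun k => ENNReal.tsum_le_tsum fun n => hkn k n).trans ?_
    simp_rw [ENNReal.tsum_mul_left]
    rw [ENNReal.tsum_mul_right, ENNReal.tsum_mul_left]

/-! ### Nonuniformly expanding maps -/

open Classical in
/-- The return time, cut off to `0` outside of the union of the partition. -/
noncomputable def cutoffTime {M : Type*} (α : Set (Set M)) (τ : M → ℕ) (x : M) : ℕ :=
  -- Off the partition `τ` is arbitrary. The value `0` makes the time measurable, and the induced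
  -- map becomes the identity there.
  if x ∈ ⋃₀ α then τ x else 0

lemma cutoffTime_of_mem {M : Type*} {α : Set (Set M)} {τ : M → ℕ} {a : Set M} (ha : a ∈ α) {x : M}
    (hx : x ∈ a) : cutoffTime α τ x = τ x :=
  if_pos ⟨a, ha, hx⟩

lemma inducedMap_cutoffTime_of_mem {M : Type*} {T : M → M} {α : Set (Set M)} {τ : M → ℕ} {a : Set M}
    (ha : a ∈ α) {x : M} (hx : x ∈ a) : inducedMap T (cutoffTime α τ) x = inducedMap T τ x := by
  simp only [inducedMap, cutoffTime_of_mem ha hx]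

lemma measurable_cutoffTime {M : Type*} [MeasurableSpace M] {α : Set (Set M)} {τ : M → ℕ}
    (hc : α.Countable) (hm : ∀ a ∈ α, MeasurableSet a) (hτ : ∀ a ∈ α, ∃ k, ∀ x ∈ a, τ x = k) :
    Measurable (cutoffTime α τ) := by
  intro B _
  have h : cutoffTime α τ ⁻¹' B =
      ((⋃₀ α)ᶜ ∩ {_x | 0 ∈ B}) ∪ ⋃ a ∈ α, a ∩ cutoffTime α τ ⁻¹' B := by
    ext x
    by_cases hx : x ∈ ⋃₀ α
    · obtain ⟨a, ha, hxa⟩ := hx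
      have hx' : x ∈ ⋃₀ α := ⟨a, ha, hxa⟩
      simp only [mem_preimage, mem_union, mem_inter_iff, mem_compl_iff, hx', not_true,
        false_and, false_or, mem_iUnion, exists_prop]
      exact ⟨fun h => ⟨a, ha, hxa, h⟩, fun ⟨_, _, _, h⟩ => h⟩
    · have h0 : cutoffTime α τ x = 0 := if_neg hx
      simp only [mem_preimage, h0, mem_union, mem_inter_iff, mem_compl_iff, hx, not_false_eq_true,
        true_and, mem_ofPred_eq, mem_iUnion, exists_prop]
      exact ⟨Or.inl, fun h => h.elim id fun ⟨_, _, _, h⟩ => h⟩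
  rw [h]
  refine ((MeasurableSet.sUnion hc hm).compl.inter (MeasurableSet.const _)).union
    (MeasurableSet.biUnion hc fun a ha => ?_)
  obtain ⟨k, hk⟩ := hτ a ha
  by_cases hkB : k ∈ B
  · rw [inter_eq_left.2 fun x hx => ?_]
    · exact hm a ha
    · rwa [mem_preimage, cutoffTime_of_mem ha hx, hk x hx]
  · rw [show a ∩ cutoffTime α τ ⁻¹' B = ∅ from ?_]
    · exact MeasurableSet.empty
    · refine eq_empty_of_forall_notMem fun x hx => hkB ?_
      have := hx.2
      rwa [mem_preimage, cutoffTime_of_mem ha hx.1, hk x hx.1] at this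

lemma measurable_inducedMap {M : Type*} [MeasurableSpace M] {T : M → M} {τ : M → ℕ}
    (hT : Measurable T) (hτ : Measurable τ) : Measurable (inducedMap T τ) := by
  have h : Measurable fun p : ℕ × M => T^[p.1] p.2 :=
    measurable_from_prod_countable_right fun k => hT.iterate k
  exact h.comp (hτ.prodMk measurable_id)

lemma HarnackOn.abs_log_le {M : Type*} [MetricSpace M] {R : ℝ} {g : M → ℝ≥0∞} {Y : Set M} (hg : HarnackOn R g Y)
    (hpos : ∀ x ∈ Y, g x ≠ 0) (hfin : ∀ x ∈ Y, g x ≠ ⊤) {x y : M} (hx : x ∈ Y) (hy : y ∈ Y) :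
    |Real.log (g x).toReal - Real.log (g y).toReal| ≤ R * dist x y := by
  have key : ∀ x ∈ Y, ∀ y ∈ Y,
      Real.log (g x).toReal - Real.log (g y).toReal ≤ R * dist x y := by
    intro x hx y hy
    have h := ENNReal.toReal_mono (ENNReal.mul_ne_top ENNReal.ofReal_ne_top (hfin y hy))
      (hg x hx y hy)
    rw [ENNReal.toReal_mul, ENNReal.toReal_ofReal (Real.exp_pos _).le] at h
    have hx0 := ENNReal.toReal_pos (hpos x hx) (hfin x hx)
    have hy0 := ENNReal.toReal_pos (hpos y hy) (hfin y hy)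
    have := Real.log_le_log hx0 h
    rw [Real.log_mul (Real.exp_pos _).ne' hy0.ne', Real.log_exp] at this
    linarith
  rw [abs_le]
  have := key y hy x hx
  rw [dist_comm] at this
  exact ⟨by linarith, key x hx y hy⟩

/-! ### Inverse Jacobians as functions of the image point -/

section Jacobian

variable {M : Type*} [MeasurableSpace M] {F F' : M → M} {α : Set (Set M)}
  {π : Measure M} {ζ : M → ℝ}

/-- Apply the defining identity to `A ∩ F⁻¹ B`. Writing `ζ` as `J ∘ F'` makes the density a function
of the image point. -/
lemma IsInverseJacobian.restrict_image (h : IsInverseJacobian F α π ζ) {a : Set M} (ha : a ∈ α)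
    (hF' : Measurable F') (hFF' : EqOn F' F a) {J : M → ℝ≥0∞}
    (hJ : ∀ x ∈ a, J (F' x) = ENNReal.ofReal (ζ x)) {A : Set M} (hA : MeasurableSet A)
    (hAa : A ⊆ a) :
    π.restrict (F '' A) = ((π.restrict A).withDensity fun x => (J (F' x))⁻¹).map F' := by
  ext B hB
  have him : B ∩ F '' A = F '' (A ∩ F' ⁻¹' B) := by
    rw [inter_comm, ← (hFF'.mono hAa).image_eq, ← image_inter_preimage]
    exact (hFF'.mono (inter_subset_left.trans hAa)).image_eq
  rw [Measure.restrict_apply hB, him, (h a ha).2 _ (hA.inter (hF' hB))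
    (inter_subset_left.trans hAa), Measure.map_apply hF' hB, withDensity_apply _ (hF' hB),
    Measure.restrict_restrict (hF' hB), inter_comm]
  refine setLIntegral_congr_fun ((hF' hB).inter hA) fun x hx => ?_
  have hx := hAa hx.2
  rw [hJ x hx, ENNReal.ofReal_inv_of_pos ((h a ha).1 x hx)]

/-- Bounded distortion makes `ζ` a log-Lipschitz function of `F x`, so it factors through a
measurable `J`, although `ζ` itself is not assumed measurable. -/
lemma exists_jacobian_extension {M : Type*} [MetricSpace M] [MeasurableSpace M] [BorelSpace M]
    {F F' : M → M} {α : Set (Set M)} {π : Measure M} {ζ : M → ℝ} {K : ℝ} (hK : 0 ≤ K)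
    (h : IsInverseJacobian F α π ζ) {a : Set M} (ha : a ∈ α) (hFF' : EqOn F' F a)
    (hd : ∀ x ∈ a, ∀ y ∈ a, |Real.log (ζ x) - Real.log (ζ y)| ≤ K * dist (F x) (F y)) :
    ∃ J : M → ℝ≥0∞, Measurable J ∧ HarnackOn K J univ ∧
      ∀ x ∈ a, J (F' x) = ENNReal.ofReal (ζ x) := by
  obtain ⟨J, hJ, hJH, hJa⟩ := exists_harnackOn_extension hK (fun x : a => F x)
    (fun x : a => ENNReal.ofReal (ζ x)) fun x y =>
      ofReal_le_of_abs_log_sub_le ((h a ha).1 x x.2) ((h a ha).1 y y.2) (hd x x.2 y y.2)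
  exact ⟨J, hJ, hJH, fun x hx => by rw [hFF' hx]; exact hJa ⟨x, hx⟩⟩

end Jacobian

lemma ne_zero_of_ofReal_inv_exp_le {c : ℝ≥0∞} {r : ℝ} (h : ENNReal.ofReal (Real.exp r)⁻¹ ≤ c) :
    c ≠ 0 :=
  ((ENNReal.ofReal_pos.2 (inv_pos.2 (Real.exp_pos _))).trans_le h).ne'

namespace IsNonuniformlyExpanding

variable {M : Type*} [MetricSpace M] [MeasurableSpace M] {T : M → M}
  {m π μ : Measure M} {Y : Set M} {α : Set (Set M)} {τ : M → ℕ} {lam Khat K R : ℝ}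

lemma ae_mem_sUnion (N : IsNonuniformlyExpanding T m Y α τ lam Khat) (hY : π Yᶜ = 0) (hπ : π ≪ m) :
    ∀ᵐ x ∂π, x ∈ ⋃₀ α := by
  have h : π ((Y \ ⋃₀ α) ∪ Yᶜ) = 0 := measure_union_null (hπ N.cover) hY
  refine measure_mono_null (fun x hx => ?_) h
  by_cases hxY : x ∈ Y
  · exact Or.inl ⟨hxY, hx⟩
  · exact Or.inr hxY

lemma cutoffTime_ae_eq (N : IsNonuniformlyExpanding T m Y α τ lam Khat) (hY : π Yᶜ = 0)
    (hπ : π ≪ m) : cutoffTime α τ =ᵐ[π] τ := by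
  filter_upwards [N.ae_mem_sUnion hY hπ] with x hx
  exact if_pos hx

lemma measurable_cutoffTime (N : IsNonuniformlyExpanding T m Y α τ lam Khat) :
    Measurable (cutoffTime α τ) :=
  _root_.measurable_cutoffTime N.countable_partition N.measurableSet_of_mem N.τ_const

lemma map_inducedMap_eq (N : IsNonuniformlyExpanding T m Y α τ lam Khat)
    (hμ : IsInducedACIP T m Y τ μ) : μ.map (inducedMap T (cutoffTime α τ)) = μ := by
  ext A hA
  rw [Measure.map_apply (measurable_inducedMap N.nonsingular.measurable N.measurable_cutoffTime) hA,
    ← hμ.invariant A hA]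
  refine measure_congr ?_
  filter_upwards [N.cutoffTime_ae_eq hμ.supported hμ.absolutelyContinuous] with x hx
  change (inducedMap T (cutoffTime α τ) x ∈ A) = (inducedMap T τ x ∈ A)
  simp only [inducedMap, hx]

lemma isInducedACIP (N : IsNonuniformlyExpanding T m Y α τ lam Khat) [IsProbabilityMeasure μ]
    (hY : μ Yᶜ = 0) (hac : μ ≪ m) (hinv : μ.map (inducedMap T (cutoffTime α τ)) = μ) :
    IsInducedACIP T m Y τ μ := by
  refine ⟨inferInstance, hY, hac, fun A hA => ?_⟩
  conv_rhs => rw [← hinv, Measure.map_apply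
    (measurable_inducedMap N.nonsingular.measurable N.measurable_cutoffTime) hA]
  refine measure_congr ?_
  filter_upwards [N.cutoffTime_ae_eq hY hac] with x hx
  change (inducedMap T τ x ∈ A) = (inducedMap T (cutoffTime α τ) x ∈ A)
  simp only [inducedMap, hx]

lemma hasBoundedDistortion_cond (N : IsNonuniformlyExpanding T m Y α τ lam Khat) :
    HasBoundedDistortion (inducedMap T τ) α (cond m Y) Khat := by
  obtain ⟨ζ, hζ, hd⟩ := N.distortion
  refine ⟨ζ, fun a ha => ⟨(hζ a ha).1, fun A hA hAa => ?_⟩, hd⟩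
  have hFA : inducedMap T τ '' A ⊆ Y := by
    rintro _ ⟨x, hx, rfl⟩
    exact N.mapsTo a ha (hAa hx)
  rw [ProbabilityTheory.cond, Measure.smul_apply, Measure.restrict_apply' N.measurableSet_Y,
    inter_eq_left.2 hFA, (hζ a ha).2 A hA hAa, Measure.restrict_smul, lintegral_smul_measure,
    Measure.restrict_restrict hA, inter_eq_left.2 (hAa.trans (N.subset_Y a ha))]

variable [BorelSpace M]

/-- Since `F a` has full measure in `Y`, the Jacobian identity reads `π = J⁻¹ · F_*(π|a)`. On the
image of `a` the function `J` is positive and finite, so the identity can be inverted to `F_*(π|a) =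
J · π`. -/
lemma markovSystem (N : IsNonuniformlyExpanding T m Y α τ lam Khat) [IsProbabilityMeasure π]
    (hY : π Yᶜ = 0) (hπ : π ≪ m) (hK : 0 ≤ K)
    (hd : HasBoundedDistortion (inducedMap T τ) α π K) :
    MarkovSystem (inducedMap T (cutoffTime α τ)) π Y α lam K := by
  have hF := measurable_inducedMap N.nonsingular.measurable N.measurable_cutoffTime
  have heq : ∀ a ∈ α, EqOn (inducedMap T (cutoffTime α τ)) (inducedMap T τ) a :=
    fun a ha x hx => inducedMap_cutoffTime_of_mem ha hx
  refine ⟨hF, inferInstance, hY, N.diam_le_one, N.countable_partition, N.measurableSet_of_mem,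
    N.subset_Y, N.disjoint, N.ae_mem_sUnion hY hπ, fun a ha => (N.mapsTo a ha).congr (heq a ha).symm,
    N.one_lt_lam, hK, fun a ha x hx y hy => ?_, fun a ha => ?_⟩
  · rw [heq a ha hx, heq a ha hy]
    exact N.expanding a ha x hx y hy
  · obtain ⟨ζ, hζ, hζd⟩ := hd
    obtain ⟨J, hJ, hJH, hJa⟩ := exists_jacobian_extension hK hζ ha (heq a ha) (hζd a ha)
    refine ⟨J, hJ, hJH.mono_set (subset_univ _), ?_⟩
    have h1 := hζ.restrict_image ha hF (heq a ha) hJa (N.measurableSet_of_mem a ha) Subset.rfl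
    have hfull : ∀ᵐ x ∂π, x ∈ inducedMap T τ '' a := by
      have h : π ((Y \ inducedMap T τ '' a) ∪ Yᶜ) = 0 :=
        measure_union_null (hπ (N.onto a ha)) hY
      refine measure_mono_null (fun x hx => ?_) h
      by_cases hxY : x ∈ Y
      · exact Or.inl ⟨hxY, hx⟩
      · exact Or.inr hxY
    rw [Measure.restrict_eq_self_of_ae_mem hfull,
      map_withDensity_comp (g := fun y => (J y)⁻¹) hF hJ.inv] at h1
    set ν := (π.restrict a).map (inducedMap T (cutoffTime α τ)) with hν
    have hae : ∀ᵐ y ∂ν, (J y)⁻¹ ≠ 0 ∧ (J y)⁻¹ ≠ ⊤ := by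
      have hms : MeasurableSet {y | (J y)⁻¹ ≠ 0 ∧ (J y)⁻¹ ≠ ⊤} :=
        ((hJ.inv (measurableSet_singleton 0)).compl).inter
          ((hJ.inv (measurableSet_singleton ⊤)).compl)
      rw [hν, ae_map_iff hF.aemeasurable hms]
      filter_upwards [ae_restrict_mem (N.measurableSet_of_mem a ha)] with x hx
      rw [hJa x hx]
      simpa using (hζ a ha).1 x hx
    have h2 : (ν.withDensity fun y => (J y)⁻¹).withDensity J = ν := by
      have := withDensity_inv_same (μ := ν) hJ.inv (hae.mono fun _ h => h.1)
        (hae.mono fun _ h => h.2)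
      simp only [Pi.inv_apply, inv_inv] at this
      exact this
    conv_rhs => rw [h1]
    exact h2.symm

/-- A log-Lipschitz change of density preserves bounded distortion. -/
lemma hasBoundedDistortion_withDensity (N : IsNonuniformlyExpanding T m Y α τ lam Khat)
    [SFinite π] (hK : 0 ≤ K) (hR : 0 ≤ R) {h : M → ℝ≥0∞} (hh : Measurable h) (hH : HarnackOn R h Y)
    (hpos : ∀ x ∈ Y, h x ≠ 0) (hfin : ∀ x ∈ Y, h x ≠ ⊤)
    (hd : HasBoundedDistortion (inducedMap T τ) α π K) :
    HasBoundedDistortion (inducedMap T τ) α (π.withDensity h) (2 * R + K) := by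
  obtain ⟨ζ, hζ, hd⟩ := hd
  set F := inducedMap T τ
  have hF' := measurable_inducedMap N.nonsingular.measurable N.measurable_cutoffTime
  have heq : ∀ a ∈ α, EqOn (inducedMap T (cutoffTime α τ)) F a :=
    fun a ha x hx => inducedMap_cutoffTime_of_mem ha hx
  have hreal : ∀ x ∈ Y, 0 < (h x).toReal := fun x hx => ENNReal.toReal_pos (hpos x hx) (hfin x hx)
  -- The change of variables for the density `h`: the inverse Jacobian is multiplied by `h / (h ∘
  -- F)`.
  refine ⟨fun x => (h x).toReal * ζ x / (h (F x)).toReal, fun a ha => ⟨fun x hx => ?_,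
    fun A hA hAa => ?_⟩, fun a ha x hx y hy => ?_⟩
  · exact div_pos (mul_pos (hreal x (N.subset_Y a ha hx)) ((hζ a ha).1 x hx))
      (hreal _ (N.mapsTo a ha hx))
  · obtain ⟨J, hJ, -, hJa⟩ := exists_jacobian_extension hK hζ ha (heq a ha) (hd a ha)
    have him := hζ.restrict_image ha hF' (heq a ha) hJa hA hAa
    set F' := inducedMap T (cutoffTime α τ)
    have hJF : Measurable fun x => (J (F' x))⁻¹ := (hJ.comp hF').inv
    have hhF : Measurable fun x => h (F' x) := hh.comp hF'
    rw [withDensity_apply', him, lintegral_map hh hF',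
      lintegral_withDensity_eq_lintegral_mul _ hJF hhF]
    have hpt : ∀ x ∈ A, ENNReal.ofReal ((h x).toReal * ζ x / (h (F x)).toReal)⁻¹ =
        (h x)⁻¹ * ((J (F' x))⁻¹ * h (F' x)) := by
      intro x hx
      have hxa := hAa hx
      have hxY := N.subset_Y a ha hxa
      have hFY : F x ∈ Y := N.mapsTo a ha hxa
      rw [hJa x hxa, heq a ha hxa, inv_div, div_eq_mul_inv, mul_inv,
        ENNReal.ofReal_mul ENNReal.toReal_nonneg, ENNReal.ofReal_toReal (hfin _ hFY),
        ENNReal.ofReal_mul (inv_nonneg.2 ENNReal.toReal_nonneg),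
        ENNReal.ofReal_inv_of_pos (hreal x hxY), ENNReal.ofReal_toReal (hfin x hxY),
        ENNReal.ofReal_inv_of_pos ((hζ a ha).1 x hxa)]
      ring
    rw [setLIntegral_congr_fun hA hpt, restrict_withDensity hA,
      lintegral_withDensity_eq_lintegral_mul _ hh
        (show Measurable fun x => (h x)⁻¹ * ((J (F' x))⁻¹ * h (F' x)) from
          hh.inv.mul (hJF.mul hhF))]
    refine setLIntegral_congr_fun hA fun x hx => ?_
    have hxY := N.subset_Y a ha (hAa hx)
    simp only [Pi.mul_apply]
    rw [← mul_assoc (h x), ENNReal.mul_inv_cancel (hpos x hxY) (hfin x hxY), one_mul]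
  · have hxY := N.subset_Y a ha hx
    have hyY := N.subset_Y a ha hy
    have hFx : F x ∈ Y := N.mapsTo a ha hx
    have hFy : F y ∈ Y := N.mapsTo a ha hy
    have hlog : ∀ z ∈ a, Real.log ((h z).toReal * ζ z / (h (F z)).toReal) =
        Real.log (h z).toReal + Real.log (ζ z) - Real.log (h (F z)).toReal := fun z hz => by
      have h1 := (hreal z (N.subset_Y a ha hz)).ne'
      have h2 := ((hζ a ha).1 z hz).ne'
      rw [Real.log_div (mul_ne_zero h1 h2) (hreal _ (N.mapsTo a ha hz)).ne', Real.log_mul h1 h2]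
    simp only [hlog x hx, hlog y hy]
    have h1 := hH.abs_log_le hpos hfin hxY hyY
    have h2 := hd a ha x hx y hy
    have h3 := hH.abs_log_le hpos hfin hFx hFy
    -- Expansion lets both factors `h` be measured at the image points, which gives `2 * R` in the
    -- constant.
    have h4 : dist x y ≤ dist (F x) (F y) := by
      have := N.expanding a ha x hx y hy
      nlinarith [N.one_lt_lam, dist_nonneg (x := x) (y := y)]
    have h5 : R * dist x y ≤ R * dist (F x) (F y) := by gcongr
    rw [abs_le] at h1 h2 h3 ⊢
    constructor <;> nlinarith

/-- The constant of the bounds on the density and on the distortion of the invariant measure. -/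
noncomputable def densityBound (p : ℝ × ℝ) : ℝ :=
  -- With `R = Khat λ / (λ - 1) + 1` the density is bounded by `e^R` and the distortion by `2R +
  -- Khat`; `e^{2R + Khat}` dominates both.
  Real.exp (2 * (p.2 * p.1 / (p.1 - 1) + 1) + p.2)

lemma continuousOn_densityBound : ContinuousOn densityBound {p | 1 < p.1 ∧ 0 ≤ p.2} := by
  refine Real.continuous_exp.comp_continuousOn (ContinuousOn.add (ContinuousOn.mul
    continuousOn_const (ContinuousOn.add (ContinuousOn.div (by fun_prop) (by fun_prop)
      fun p hp => ?_) continuousOn_const)) (by fun_prop))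
  exact sub_ne_zero.2 hp.1.ne'

/-- The density given by `exists_invariant` is log-Lipschitz with mean `1`, hence between `e^{-R}`
and `e^R` on `Y`. -/
lemma exists_density (N : IsNonuniformlyExpanding T m Y α τ lam Khat) [IsProbabilityMeasure m] :
    ∃ h : M → ℝ≥0∞, Measurable h ∧
      HarnackOn (Khat * lam / (lam - 1) + 1) h Y ∧
      (∀ x ∈ Y, ENNReal.ofReal (Real.exp (Khat * lam / (lam - 1) + 1))⁻¹ ≤ h x ∧
        h x ≤ ENNReal.ofReal (Real.exp (Khat * lam / (lam - 1) + 1))) ∧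
      IsInducedACIP T m Y τ ((cond m Y).withDensity h) := by
  have : IsProbabilityMeasure (cond m Y) := cond_isProbabilityMeasure N.measure_Y_pos.ne'
  have hY : cond m Y Yᶜ = 0 := by
    rw [cond_apply N.measurableSet_Y]; simp
  have hπ : cond m Y ≪ m := cond_absolutelyContinuous
  have S := N.markovSystem hY hπ N.Khat_nonneg N.hasBoundedDistortion_cond
  have hR := lt_add_one (Khat * lam / (lam - 1))
  have hR0 := rate_pos S.one_lt_lam S.nonneg hR
  obtain ⟨μ, hprob, ⟨h, hh, hH, rfl⟩, hinv⟩ := S.exists_invariant hR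
  have hac := withDensity_absolutelyContinuous (cond m Y) h
  refine ⟨h, hh, hH, fun x hx => ?_, N.isInducedACIP (hac hY) (hac.trans hπ) hinv⟩
  have h1 : ∫⁻ x, h x ∂(cond m Y) = 1 := by
    have := measure_univ (μ := (cond m Y).withDensity h)
    rwa [withDensity_apply _ MeasurableSet.univ, setLIntegral_univ] at this
  have h2 := hH.lintegral_le S.ae_mem hR0.le S.diam_le_one hx
  have h3 := hH.le_lintegral S.ae_mem hR0.le S.diam_le_one hx
  rw [h1] at h2
  rw [h1, mul_one] at h3
  refine ⟨?_, h3⟩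
  rw [ENNReal.ofReal_inv_of_pos (Real.exp_pos _), ← mul_one (ENNReal.ofReal _)⁻¹]
  exact (ENNReal.inv_mul_le_iff (by simp [Real.exp_pos]) ENNReal.ofReal_ne_top).2 h2

/-- As `h` is positive on `Y`, a competitor is absolutely continuous with respect to `μ`. By the
distortion bound `μ` is itself the reference measure of a Markov system, hence ergodic. -/
lemma unique (N : IsNonuniformlyExpanding T m Y α τ lam Khat) [IsProbabilityMeasure m]
    {h : M → ℝ≥0∞} (hh : Measurable h) (hH : HarnackOn (Khat * lam / (lam - 1) + 1) h Y)
    (hb : ∀ x ∈ Y, ENNReal.ofReal (Real.exp (Khat * lam / (lam - 1) + 1))⁻¹ ≤ h x ∧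
      h x ≤ ENNReal.ofReal (Real.exp (Khat * lam / (lam - 1) + 1)))
    (hμ : IsInducedACIP T m Y τ ((cond m Y).withDensity h)) {μ' : Measure M}
    (hμ' : IsInducedACIP T m Y τ μ') : μ' = (cond m Y).withDensity h := by
  have := hμ.isProbabilityMeasure
  have := hμ'.isProbabilityMeasure
  have hR0 := rate_pos N.one_lt_lam N.Khat_nonneg (lt_add_one (Khat * lam / (lam - 1)))
  have hpos : ∀ x ∈ Y, h x ≠ 0 := fun x hx => ne_zero_of_ofReal_inv_exp_le (hb x hx).1
  have hfin : ∀ x ∈ Y, h x ≠ ⊤ := fun x hx =>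
    ne_top_of_le_ne_top ENNReal.ofReal_ne_top (hb x hx).2
  have S := N.markovSystem hμ.supported hμ.absolutelyContinuous (by linarith [N.Khat_nonneg])
    (N.hasBoundedDistortion_withDensity N.Khat_nonneg hR0.le hh hH hpos hfin
      N.hasBoundedDistortion_cond)
  have hac : μ' ≪ (cond m Y).withDensity h := by
    have hY : ∀ᵐ x ∂(cond m Y), x ∈ Y := by
      change cond m Y Yᶜ = 0
      rw [cond_apply N.measurableSet_Y]; simp
    refine Measure.AbsolutelyContinuous.trans ?_
      (withDensity_absolutelyContinuous' hh.aemeasurable (hY.mono hpos))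
    refine Measure.AbsolutelyContinuous.mk fun A hA h0 => ?_
    rw [cond_apply N.measurableSet_Y, mul_eq_zero] at h0
    have h1 : m (Y ∩ A) = 0 := h0.resolve_left (ENNReal.inv_ne_zero.2 (measure_ne_top _ _))
    refine measure_mono_null (fun x hx => ?_)
      (measure_union_null (hμ'.absolutelyContinuous h1) hμ'.supported)
    by_cases hxY : x ∈ Y
    · exact Or.inl ⟨hxY, hx⟩
    · exact Or.inr hxY
  exact (S.ergodic (N.map_inducedMap_eq hμ)).eq_of_absolutelyContinuous
    ⟨S.measurable_map, N.map_inducedMap_eq hμ'⟩ hac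

lemma exists_unique_isInducedACIP (N : IsNonuniformlyExpanding T m Y α τ lam Khat)
    [IsProbabilityMeasure m] : ∃! μ : Measure M, IsInducedACIP T m Y τ μ := by
  obtain ⟨h, hh, hH, hb, hμ⟩ := N.exists_density
  exact ⟨_, hμ, fun μ' hμ' => N.unique hh hH hb hμ hμ'⟩

lemma density_and_distortion_bounds (N : IsNonuniformlyExpanding T m Y α τ lam Khat)
    [IsProbabilityMeasure m] (hμ : IsInducedACIP T m Y τ μ) :
    0 < densityBound (lam, Khat) ∧
      (∀ᵐ y ∂(cond m Y),
        ENNReal.ofReal (densityBound (lam, Khat))⁻¹ ≤ μ.rnDeriv (cond m Y) y ∧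
          μ.rnDeriv (cond m Y) y ≤ ENNReal.ofReal (densityBound (lam, Khat))) ∧
      HasBoundedDistortion (inducedMap T τ) α μ (densityBound (lam, Khat)) := by
  obtain ⟨h, hh, hH, hb, hμ₀⟩ := N.exists_density
  obtain rfl := N.unique hh hH hb hμ₀ hμ
  have hR0 := rate_pos N.one_lt_lam N.Khat_nonneg (lt_add_one (Khat * lam / (lam - 1)))
  have hK0 := N.Khat_nonneg
  have : IsProbabilityMeasure (cond m Y) := cond_isProbabilityMeasure N.measure_Y_pos.ne'
  have hle : Real.exp (Khat * lam / (lam - 1) + 1) ≤ densityBound (lam, Khat) :=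
    Real.exp_le_exp.2 (by simp only; linarith)
  refine ⟨Real.exp_pos _, ?_, ?_⟩
  · have hY : ∀ᵐ x ∂(cond m Y), x ∈ Y := by
      change cond m Y Yᶜ = 0
      rw [cond_apply N.measurableSet_Y]; simp
    filter_upwards [Measure.rnDeriv_withDensity (cond m Y) hh, hY] with y hy hyY
    rw [hy]
    refine ⟨le_trans ?_ (hb y hyY).1, (hb y hyY).2.trans (ENNReal.ofReal_le_ofReal hle)⟩
    exact ENNReal.ofReal_le_ofReal (inv_anti₀ (Real.exp_pos _) hle)
  · obtain ⟨ζ, hζ, hd⟩ := N.hasBoundedDistortion_withDensity hK0 hR0.le hh hH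
      (fun x hx => ne_zero_of_ofReal_inv_exp_le (hb x hx).1)
      (fun x hx => ne_top_of_le_ne_top ENNReal.ofReal_ne_top (hb x hx).2)
      N.hasBoundedDistortion_cond
    refine ⟨ζ, hζ, fun a ha x hx y hy => (hd a ha x hx y hy).trans ?_⟩
    gcongr
    have := Real.add_one_le_exp (2 * (Khat * lam / (lam - 1) + 1) + Khat)
    simp only [densityBound]
    linarith

end IsNonuniformlyExpanding

/-! ### Mixtures of measures with log-Lipschitz densities -/

section Mixture

open Filter Topology

variable {M : Type*} [MetricSpace M] {R : ℝ}

/-- The largest possible ratio of the values of a log-Lipschitz function at `x` and at a point of the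
ball of radius `δ` centred at `q`. -/
noncomputable def ballRatio (R : ℝ) (q : M) (δ : ℝ) (x : M) : ℝ≥0∞ :=
  ENNReal.ofReal (Real.exp (R * (dist x q + δ)))

lemma ballRatio_eq (q : M) (δ : ℝ) (x : M) : ballRatio R q δ x =
    ENNReal.ofReal (Real.exp (R * δ)) * ENNReal.ofReal (Real.exp (R * dist x q)) := by
  rw [ballRatio, ← ENNReal.ofReal_mul (Real.exp_pos _).le, ← Real.exp_add]
  ring_nf

lemma exp_dist_le_ballRatio (hR : 0 ≤ R) {q x y : M} {δ : ℝ} (hy : y ∈ Metric.ball q δ) :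
    ENNReal.ofReal (Real.exp (R * dist x y)) ≤ ballRatio R q δ x := by
  unfold ballRatio
  gcongr
  linarith [dist_triangle_right x y q, Metric.mem_ball.1 hy]

variable [MeasurableSpace M] [BorelSpace M] {μ η : Measure M} {Y : Set M}

@[fun_prop]
lemma measurable_ballRatio (q : M) (δ : ℝ) : Measurable (ballRatio R q δ) := by
  unfold ballRatio
  fun_prop

/-- The Harnack inequality integrated over `x ∈ A` and `y` in a ball. It involves measures in place
of densities, so it can be integrated over the parameter of a mixture. -/
lemma HasLogLipschitzDensity.measure_mul_ball_le (hY : ∀ᵐ x ∂μ, x ∈ Y) (hR : 0 ≤ R)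
    (hη : HasLogLipschitzDensity μ Y R η) {A : Set M} (hA : MeasurableSet A) (q : M) (δ : ℝ) :
    η A * μ (Metric.ball q δ) ≤ (∫⁻ x in A, ballRatio R q δ x ∂μ) * η (Metric.ball q δ) := by
  obtain ⟨φ, hφ, hH, rfl⟩ := hη
  rw [withDensity_apply _ hA, ← lintegral_mul_const _ hφ,
    ← lintegral_mul_const _ (measurable_ballRatio q δ), withDensity_apply _ measurableSet_ball]
  refine lintegral_mono_ae (ae_restrict_of_ae (hY.mono fun x hx => ?_))
  rw [← setLIntegral_const, ← lintegral_const_mul _ hφ]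
  refine setLIntegral_mono_ae' measurableSet_ball (hY.mono fun y hy hyb => ?_)
  exact (hH x hx y hy).trans (mul_le_mul_left (exp_dist_le_ballRatio hR hyb) _)

lemma HasLogLipschitzDensity.ball_mul_measure_le (hY : ∀ᵐ x ∂μ, x ∈ Y) (hR : 0 ≤ R)
    (hη : HasLogLipschitzDensity μ Y R η) {A : Set M} (hA : MeasurableSet A) (q : M) (δ : ℝ) :
    η (Metric.ball q δ) * μ A ≤ μ (Metric.ball q δ) * ∫⁻ x in A, ballRatio R q δ x ∂η := by
  obtain ⟨φ, hφ, hH, rfl⟩ := hη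
  have hm := measurable_ballRatio (R := R) q δ
  rw [restrict_withDensity hA, lintegral_withDensity_eq_lintegral_mul _ hφ hm,
    withDensity_apply _ measurableSet_ball, ← setLIntegral_const,
    ← lintegral_const_mul _ (hφ.mul hm)]
  refine lintegral_mono_ae (ae_restrict_of_ae (hY.mono fun x hx => ?_))
  rw [mul_comm, ← setLIntegral_const]
  refine setLIntegral_mono_ae' measurableSet_ball (hY.mono fun y hy hyb => ?_)
  refine (hH y hy x hx).trans ?_
  rw [dist_comm, mul_comm, Pi.mul_apply]
  exact mul_le_mul_right (exp_dist_le_ballRatio hR hyb) _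

/-- Mixtures of measures with log-Lipschitz densities have log-Lipschitz densities, without any
joint measurability of the densities. -/
lemma HasLogLipschitzDensity.bind [IsProbabilityMeasure μ] (hY : ∀ᵐ x ∂μ, x ∈ Y) (hR : 0 ≤ R)
    {Q : Set M} (hQ : Q.Countable) (hQμ : ∀ᵐ x ∂μ, x ∈ closure Q)
    {E : Type*} [MeasurableSpace E] {κ : Measure E} {η : E → Measure M} (hη : Measurable η)
    [IsFiniteMeasure (κ.bind η)] (h : ∀ᵐ z ∂κ, HasLogLipschitzDensity μ Y R (η z)) :
    HasLogLipschitzDensity μ Y R (κ.bind η) := by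
  set ν := κ.bind η with hν
  have hνapply : ∀ {A : Set M}, MeasurableSet A → ν A = ∫⁻ z, η z A ∂κ := fun hA =>
    Measure.bind_apply hA hη.aemeasurable
  have hηm : ∀ {A : Set M}, MeasurableSet A → Measurable fun z => η z A := fun hA =>
    (Measure.measurable_coe hA).comp hη
  have hac : ν ≪ μ := by
    refine Measure.AbsolutelyContinuous.mk fun A hA h0 => ?_
    rw [hνapply hA, lintegral_eq_zero_iff (hηm hA)]
    filter_upwards [h] with z hz
    obtain ⟨φ, -, -, hφ⟩ := hz
    rw [hφ]
    exact withDensity_absolutelyContinuous _ _ h0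
  set f := ν.rnDeriv μ
  have hf : Measurable f := Measure.measurable_rnDeriv _ _
  have hfν : μ.withDensity f = ν := Measure.withDensity_rnDeriv_eq ν μ hac
  have hball : ∀ (q : M) (δ : ℝ), MeasurableSet (Metric.ball q δ) := fun _ _ => measurableSet_ball
  have upper : ∀ (q : M) (δ : ℝ), ∀ᵐ x ∂μ,
      f x * μ (Metric.ball q δ) ≤ ballRatio R q δ x * ν (Metric.ball q δ) := by
    intro q δ
    refine ae_le_of_forall_setLIntegral_le_of_sigmaFinite (hf.mul_const _) fun A hA _ => ?_
    rw [lintegral_mul_const _ hf, lintegral_mul_const _ (measurable_ballRatio q δ),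
      ← withDensity_apply _ hA, hfν, hνapply hA, hνapply (hball q δ),
      ← lintegral_mul_const _ (hηm hA), ← lintegral_const_mul _ (hηm (hball q δ))]
    exact lintegral_mono_ae (h.mono fun z hz => hz.measure_mul_ball_le hY hR hA q δ)
  have lower : ∀ (q : M) (δ : ℝ), ∀ᵐ x ∂μ,
      ν (Metric.ball q δ) ≤ μ (Metric.ball q δ) * (f x * ballRatio R q δ x) := by
    intro q δ
    have hm := measurable_ballRatio (R := R) q δ
    refine ae_le_of_forall_setLIntegral_le_of_sigmaFinite measurable_const fun A hA _ => ?_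
    have h1 : ∫⁻ x in A, f x * ballRatio R q δ x ∂μ =
        ∫⁻ z, ∫⁻ x in A, ballRatio R q δ x ∂(η z) ∂κ := by
      have := lintegral_withDensity_eq_lintegral_mul (μ.restrict A) hf hm
      rw [← restrict_withDensity hA, hfν] at this
      refine this.symm.trans ?_
      simp_rw [← lintegral_indicator hA]
      exact Measure.lintegral_bind hη.aemeasurable (hm.indicator hA).aemeasurable
    have h2 : Measurable fun z => ∫⁻ x in A, ballRatio R q δ x ∂(η z) := by
      simp_rw [← lintegral_indicator hA]
      exact (Measure.measurable_lintegral (hm.indicator hA)).comp hη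
    rw [setLIntegral_const, lintegral_const_mul _
      (show Measurable fun x => f x * ballRatio R q δ x from hf.mul hm), h1, hνapply (hball q δ),
      ← lintegral_mul_const _ (hηm (hball q δ)), ← lintegral_const_mul _ h2]
    exact lintegral_mono_ae (h.mono fun z hz => hz.ball_mul_measure_le hY hR hA q δ)
  -- The density is recovered from averages over countably many balls, as the least of the upper
  -- bounds they give. Null balls are left out: there the quotient is `0 / 0 = 0` and would make the
  -- infimum vanish.
  let r : ℕ → ℝ := fun n => 1 / ((n : ℝ) + 1)
  let g : M → ℝ≥0∞ := fun x => ⨅ (q : Q) (n : ℕ) (_ : μ (Metric.ball (q : M) (r n)) ≠ 0),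
    ν (Metric.ball (q : M) (r n)) / μ (Metric.ball (q : M) (r n)) * ballRatio R (q : M) (r n) x
  have hgH : HarnackOn R g univ := by
    refine HarnackOn.iInf fun q => HarnackOn.iInf fun n => HarnackOn.iInf fun _ => ?_
    simp_rw [ballRatio_eq, ← mul_assoc]
    exact (harnackOn_exp_dist hR _ _).const_mul _
  have := hQ.to_subtype
  have hnull : ∀ᵐ x ∂μ, ∀ (q : Q) (n : ℕ), x ∈ Metric.ball (q : M) (r n) →
      μ (Metric.ball (q : M) (r n)) ≠ 0 := by
    refine ae_all_iff.2 fun q => ae_all_iff.2 fun n => ?_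
    by_cases h0 : μ (Metric.ball (q : M) (r n)) = 0
    · filter_upwards [measure_eq_zero_iff_ae_notMem.1 h0] with x hx hx'
      exact absurd hx' hx
    · exact Eventually.of_forall fun _ _ => h0
  refine ⟨g, hgH.measurable, hgH.mono_set (subset_univ _), ?_⟩
  rw [← hfν]
  refine withDensity_congr_ae ?_
  filter_upwards [ae_all_iff.2 fun q : Q => ae_all_iff.2 fun n => upper q (r n),
    ae_all_iff.2 fun q : Q => ae_all_iff.2 fun n => lower q (r n), hnull, hQμ] with x hu hl hn hx
  refine le_antisymm ?_ ?_
  · refine le_iInf fun q => le_iInf fun n => le_iInf fun h0 => ?_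
    rw [mul_comm, ← mul_div_assoc, ENNReal.le_div_iff_mul_le (Or.inl h0)
      (Or.inl (measure_ne_top _ _))]
    exact hu q n
  -- A ball of radius `r n` around a point of `Q` close to `x` contains `x`; its two comparison
  -- factors cost `e^{2 R r}` each, and `r n → 0`.
  · have key : ∀ n, g x ≤ f x * ENNReal.ofReal (Real.exp (R * (4 * r n))) := by
      intro n
      obtain ⟨q, hq, hd⟩ := Metric.mem_closure_iff.1 hx (r n) Nat.one_div_pos_of_nat
      have h0 := hn ⟨q, hq⟩ n hd
      refine (iInf_le_of_le ⟨q, hq⟩ (iInf₂_le n h0)).trans ?_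
      have h1 : ballRatio R q (r n) x ≤ ENNReal.ofReal (Real.exp (R * (2 * r n))) := by
        unfold ballRatio
        gcongr
        linarith
      have h2 : ν (Metric.ball q (r n)) / μ (Metric.ball q (r n)) ≤ f x * ballRatio R q (r n) x := by
        rw [ENNReal.div_le_iff' h0 (measure_ne_top _ _)]
        exact hl ⟨q, hq⟩ n
      calc _ ≤ f x * ENNReal.ofReal (Real.exp (R * (2 * r n))) *
            ENNReal.ofReal (Real.exp (R * (2 * r n))) :=
            mul_le_mul' (h2.trans (mul_le_mul_right h1 _)) h1
        _ = _ := by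
            rw [mul_assoc, ← ENNReal.ofReal_mul (Real.exp_pos _).le, ← Real.exp_add,
              show R * (2 * r n) + R * (2 * r n) = R * (4 * r n) by ring]
    have hlim : Tendsto (fun n => ENNReal.ofReal (Real.exp (R * (4 * r n)))) atTop (𝓝 1) := by
      have h1 : Tendsto (fun n => Real.exp (R * (4 * r n))) atTop (𝓝 (Real.exp (R * (4 * 0)))) :=
        (Real.continuous_exp.tendsto _).comp
          ((tendsto_one_div_add_atTop_nhds_zero_nat.const_mul 4).const_mul R)
      simpa using ENNReal.tendsto_ofReal h1
    have := ENNReal.Tendsto.const_mul (a := f x) hlim (Or.inl one_ne_zero)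
    rw [mul_one] at this
    exact ge_of_tendsto' this key

/-- The given density need not be measurable; the extension of its values on `Y` is. -/
lemma IsRegularMeasure.hasLogLipschitzDensity (hY : ∀ᵐ x ∂μ, x ∈ Y) (hR : 0 ≤ R)
    (h : IsRegularMeasure Y μ R η) : HasLogLipschitzDensity μ Y R η := by
  obtain ⟨-, -, φ, hpos, hφ, rfl⟩ := h
  obtain ⟨G, hG, hGH, hGY⟩ := exists_harnackOn_extension hR (fun x : Y => (x : M))
    (fun x : Y => ENNReal.ofReal (φ x)) fun x y =>
      ofReal_le_of_abs_log_sub_le (hpos x x.2) (hpos y y.2) (hφ x x.2 y y.2)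
  refine ⟨G, hG, hGH.mono_set (subset_univ _), withDensity_congr_ae ?_⟩
  filter_upwards [hY] with x hx
  exact (hGY ⟨x, hx⟩).symm

end Mixture

/-- The part of a forward regular measure on which the jump function is equal to `k`. -/
noncomputable def jumpPart {M E : Type*} [MeasurableSpace M] [MeasurableSpace E] (κ : Measure E)
    (ρz : Kernel E M) (r : E → ℕ) (k : ℕ) : Measure M :=
  (κ.restrict (r ⁻¹' {k})).bind ρz

namespace IsForwardRegular

variable {M E : Type*} [MetricSpace M] [MeasurableSpace M] [MeasurableSpace E]
  {T : M → M} {Y : Set M} {μ ρ : Measure M} {R : ℝ} {κ : Measure E} {ρz : Kernel E M} {r : E → ℕ}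

lemma sum_jumpPart (h : IsForwardRegular T Y μ R ρ κ ρz r) :
    Measure.sum (jumpPart κ ρz r) = ρ := by
  ext A hA
  rw [Measure.sum_apply _ hA, h.disintegration, Measure.bind_apply hA ρz.measurable.aemeasurable,
    ← setLIntegral_univ, ← preimage_univ (f := r), ← iUnion_of_singleton ℕ, preimage_iUnion,
    lintegral_iUnion (fun k => h.measurable_jump (measurableSet_singleton k))
      fun i j hij => Disjoint.preimage r (by simpa using hij)]
  exact tsum_congr fun k => Measure.bind_apply hA ρz.measurable.aemeasurable

lemma tsum_mul_jumpPart (h : IsForwardRegular T Y μ R ρ κ ρz r) (f : ℕ → ℝ≥0∞) :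
    ∑' k, f k * jumpPart κ ρz r k univ = ∫⁻ z, f (r z) ∂κ := by
  have := h.isMarkovKernel
  rw [← lintegral_map (f := f) measurable_from_nat h.measurable_jump, lintegral_countable']
  refine tsum_congr fun k => ?_
  rw [jumpPart, Measure.bind_apply MeasurableSet.univ ρz.measurable.aemeasurable,
    Measure.map_apply h.measurable_jump (measurableSet_singleton k)]
  simp

lemma hasLogLipschitzDensity_jumpPart [BorelSpace M] [IsProbabilityMeasure μ]
    (h : IsForwardRegular T Y μ R ρ κ ρz r) (hT : Measurable T) (hY : ∀ᵐ x ∂μ, x ∈ Y) (hR : 0 ≤ R)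
    {Q : Set M} (hQ : Q.Countable) (hQμ : ∀ᵐ x ∂μ, x ∈ closure Q) (k : ℕ) :
    HasLogLipschitzDensity μ Y R ((jumpPart κ ρz r k).map T^[k]) := by
  have := h.isMarkovKernel
  have := h.isProbabilityMeasure
  have hη : Measurable fun z => (ρz z).map T^[k] :=
    (Measure.measurable_map _ (hT.iterate k)).comp ρz.measurable
  have heq : (jumpPart κ ρz r k).map T^[k] =
      (κ.restrict (r ⁻¹' {k})).bind fun z => (ρz z).map T^[k] := by
    ext A hA
    rw [Measure.map_apply (hT.iterate k) hA, jumpPart,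
      Measure.bind_apply (hT.iterate k hA) ρz.measurable.aemeasurable,
      Measure.bind_apply hA hη.aemeasurable]
    exact lintegral_congr fun z => (Measure.map_apply (hT.iterate k) hA).symm
  have hfin : IsFiniteMeasure ((κ.restrict (r ⁻¹' {k})).bind fun z => (ρz z).map T^[k]) := by
    constructor
    rw [Measure.bind_apply MeasurableSet.univ hη.aemeasurable]
    simp only [Measure.map_apply (hT.iterate k) MeasurableSet.univ, preimage_univ, measure_univ,
      lintegral_one]
    exact measure_lt_top _ _
  rw [heq]
  refine HasLogLipschitzDensity.bind hY hR hQ hQμ hη ?_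
  filter_upwards [ae_restrict_mem (h.measurable_jump (measurableSet_singleton k))] with z hz
  have hreg := h.regular z
  rw [show r z = k from hz] at hreg
  exact hreg.hasLogLipschitzDensity hY hR

end IsForwardRegular

/-! ### Explicit constants -/

/-- A growth `e^{εn/2}` still leaves the geometric decay `(1 - ε/2)^n`. -/
lemma one_sub_mul_exp_half_le {ε : ℝ} (h0 : 0 < ε) (h1 : ε < 1) :
    (1 - ε) * Real.exp (ε / 2) ≤ 1 - ε / 2 := by
  have h2 : (1 - ε / 2) * Real.exp (ε / 2) ≤ 1 := by
    calc (1 - ε / 2) * Real.exp (ε / 2) ≤ Real.exp (-(ε / 2)) * Real.exp (ε / 2) := by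
          gcongr; linarith [Real.add_one_le_exp (-(ε / 2))]
      _ = 1 := by rw [← Real.exp_add]; simp
  have h3 : (1 - ε) ≤ (1 - ε / 2) * (1 - ε / 2) := by nlinarith
  calc (1 - ε) * Real.exp (ε / 2) ≤ (1 - ε / 2) * (1 - ε / 2) * Real.exp (ε / 2) := by gcongr
    _ = (1 - ε / 2) * ((1 - ε / 2) * Real.exp (ε / 2)) := by ring
    _ ≤ (1 - ε / 2) * 1 := by gcongr; linarith
    _ = _ := mul_one _

/-- This is `u ≤ e^u` at `u = s x / p`, raised to the power `p`; the constant is explicit and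
continuous in the parameters. -/
lemma rpow_le_mul_exp {x p s : ℝ} (hx : 0 ≤ x) (hp : 0 < p) (hs : 0 < s) :
    x ^ p ≤ (p / s) ^ p * Real.exp (s * x) := by
  have h1 : x ≤ p / s * Real.exp (s * x / p) := by
    have := Real.add_one_le_exp (s * x / p)
    calc x = p / s * (s * x / p) := by field_simp
      _ ≤ _ := by gcongr; linarith
  calc x ^ p ≤ (p / s * Real.exp (s * x / p)) ^ p := by gcongr
    _ = (p / s) ^ p * Real.exp (s * x) := by
        rw [Real.mul_rpow (by positivity) (Real.exp_pos _).le, ← Real.exp_mul]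
        congr 2
        field_simp

lemma tsum_geometric_mul_rpow_le {ε p : ℝ} (h0 : 0 < ε) (h1 : ε < 1) (hp : 0 < p) :
    ∑' n : ℕ, ENNReal.ofReal (ε * (1 - ε) ^ n) * ENNReal.ofReal (((n : ℝ) + 2) ^ p) ≤
      ENNReal.ofReal (2 * Real.exp 1 * (2 * p / ε) ^ p) := by
  have h2 : 0 ≤ 1 - ε := by linarith
  have key : ∀ n : ℕ, ENNReal.ofReal (ε * (1 - ε) ^ n) * ENNReal.ofReal (((n : ℝ) + 2) ^ p) ≤
      ENNReal.ofReal (2 * Real.exp 1 * (2 * p / ε) ^ p) *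
        ENNReal.ofReal (ε / 2 * (1 - ε / 2) ^ n) := by
    intro n
    rw [← ENNReal.ofReal_mul (by positivity), ← ENNReal.ofReal_mul (by positivity)]
    apply ENNReal.ofReal_le_ofReal
    have h3 := rpow_le_mul_exp (x := (n : ℝ) + 2) (p := p) (s := ε / 2) (by positivity) hp
      (by positivity)
    have h4 : Real.exp (ε / 2 * ((n : ℝ) + 2)) ≤ Real.exp 1 * Real.exp (ε / 2) ^ n := by
      rw [← Real.exp_nat_mul, ← Real.exp_add]
      gcongr
      nlinarith
    have h5 : (1 - ε) ^ n * Real.exp (ε / 2) ^ n ≤ (1 - ε / 2) ^ n := by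
      rw [← mul_pow]
      exact pow_le_pow_left₀ (by positivity) (one_sub_mul_exp_half_le h0 h1) n
    have h6 : p / (ε / 2) = 2 * p / ε := by field_simp
    rw [h6] at h3
    calc ε * (1 - ε) ^ n * ((n : ℝ) + 2) ^ p
        ≤ ε * (1 - ε) ^ n * ((2 * p / ε) ^ p * (Real.exp 1 * Real.exp (ε / 2) ^ n)) := by
          gcongr
          exact h3.trans (by gcongr)
      _ = ε * (2 * p / ε) ^ p * Real.exp 1 * ((1 - ε) ^ n * Real.exp (ε / 2) ^ n) := by ring
      _ ≤ ε * (2 * p / ε) ^ p * Real.exp 1 * (1 - ε / 2) ^ n := by gcongr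
      _ = _ := by ring
  refine (ENNReal.tsum_le_tsum key).trans ?_
  rw [ENNReal.tsum_mul_left, tsum_ofReal_geometric (by positivity) (by linarith), mul_one]

/-- `∫ exp (a f^γ / 2) ≤ 1 + c` if `f` has the tail bound `c exp (-a n^γ)`. -/
lemma lintegral_exp_le_of_expTail {X : Type*} [MeasurableSpace X] {ν : Measure X}
    [IsProbabilityMeasure ν] {f : X → ℕ} (hf : Measurable f) {a γ c : ℝ} (ha : 0 < a) (hγ : 0 < γ)
    (hc : 0 < c) (h : ExpTail ν (fun x => (f x : ℕ∞)) a γ c) :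
    ∫⁻ x, ENNReal.ofReal (Real.exp (a / 2 * (f x : ℝ) ^ γ)) ∂ν ≤ ENNReal.ofReal (1 + c) := by
  let u : ℕ → ℝ := fun n => Real.exp (a / 2 * (n : ℝ) ^ γ)
  have hu0 : u 0 = 1 := by simp [u, Real.zero_rpow hγ.ne']
  have hupos : ∀ n, 0 < u n := fun n => Real.exp_pos _
  have humono : ∀ n, u n ≤ u (n + 1) := fun n => by
    simp only [u]
    gcongr
    simp
  have hrep : ∀ k : ℕ, ENNReal.ofReal (u k) =
      1 + ∑' n : ℕ, if n < k then ENNReal.ofReal (u (n + 1) - u n) else 0 := by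
    intro k
    rw [tsum_eq_sum (s := Finset.range k) fun n hn => if_neg (by simpa using hn),
      Finset.sum_congr rfl fun n hn => if_pos (Finset.mem_range.1 hn),
      ← ENNReal.ofReal_sum_of_nonneg fun n _ => sub_nonneg.2 (humono n),
      Finset.sum_range_sub, hu0, ← ENNReal.ofReal_one, ← ENNReal.ofReal_add zero_le_one]
    · simp
    · rw [sub_nonneg, ← hu0]
      exact monotone_nat_of_le_succ humono (Nat.zero_le k)
  have hms : ∀ n : ℕ, MeasurableSet {x | n < f x} := fun n => hf measurableSet_Ioi
  -- The tail bound is `c / u²`, and `(u (n+1) - u n) / u (n+1)²` is at most `1 / u n - 1 / u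
  -- (n+1)`, which telescopes.
  have hstep : ∀ n : ℕ, ∫⁻ x, (if n < f x then ENNReal.ofReal (u (n + 1) - u n) else 0) ∂ν ≤
      ENNReal.ofReal (c * ((u n)⁻¹ - (u (n + 1))⁻¹)) := by
    intro n
    have h1 : ∫⁻ x, (if n < f x then ENNReal.ofReal (u (n + 1) - u n) else 0) ∂ν =
        ENNReal.ofReal (u (n + 1) - u n) * ν {x | n < f x} := by
      rw [← setLIntegral_const, ← lintegral_indicator (hms n)]
      exact lintegral_congr fun x => by simp [indicator_apply]
    have h2 : ν {x | n < f x} ≤ ENNReal.ofReal (c * ((u (n + 1))⁻¹ * (u (n + 1))⁻¹)) := by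
      have h3 := h (n + 1) (by omega)
      have h4 : {x | ((n + 1 : ℕ) : ℕ∞) ≤ (f x : ℕ∞)} = {x | n < f x} := by
        ext x
        change ((n + 1 : ℕ) : ℕ∞) ≤ (f x : ℕ∞) ↔ n < f x
        rw [Nat.cast_le, Nat.succ_le_iff]
      rw [h4] at h3
      refine h3.trans (le_of_eq ?_)
      simp only [u]
      rw [← Real.exp_neg, ← Real.exp_add]
      congr 3
      ring
    rw [h1]
    refine (mul_le_mul_right h2 _).trans ?_
    rw [← ENNReal.ofReal_mul (sub_nonneg.2 (humono n))]
    apply ENNReal.ofReal_le_ofReal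
    have hp := hupos n
    have hp1 := hupos (n + 1)
    have h5 : (u (n + 1) - u n) * (u (n + 1))⁻¹ = u n * ((u n)⁻¹ - (u (n + 1))⁻¹) := by
      field_simp
    have h6 : u n * (u (n + 1))⁻¹ ≤ 1 := by
      rw [← div_eq_mul_inv, div_le_one hp1]; exact humono n
    have h7 : 0 ≤ (u n)⁻¹ - (u (n + 1))⁻¹ := sub_nonneg.2 (inv_anti₀ hp (humono n))
    calc (u (n + 1) - u n) * (c * ((u (n + 1))⁻¹ * (u (n + 1))⁻¹))
        = c * ((u (n + 1) - u n) * (u (n + 1))⁻¹) * (u (n + 1))⁻¹ := by ring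
      _ = c * ((u n)⁻¹ - (u (n + 1))⁻¹) * (u n * (u (n + 1))⁻¹) := by rw [h5]; ring
      _ ≤ c * ((u n)⁻¹ - (u (n + 1))⁻¹) * 1 := by gcongr
      _ = _ := mul_one _
  have hsum : ∑' n : ℕ, ENNReal.ofReal (c * ((u n)⁻¹ - (u (n + 1))⁻¹)) ≤ ENNReal.ofReal c := by
    refine ENNReal.tsum_le_of_sum_range_le fun N => ?_
    rw [← ENNReal.ofReal_sum_of_nonneg fun n _ => mul_nonneg hc.le
      (sub_nonneg.2 (inv_anti₀ (hupos n) (humono n))), ← Finset.mul_sum,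
      Finset.sum_range_sub' (fun n => (u n)⁻¹), hu0]
    apply ENNReal.ofReal_le_ofReal
    have := inv_pos.2 (hupos N)
    nlinarith
  calc ∫⁻ x, ENNReal.ofReal (u (f x)) ∂ν
      = ∫⁻ x, 1 + ∑' n : ℕ, (if n < f x then ENNReal.ofReal (u (n + 1) - u n) else 0) ∂ν :=
        lintegral_congr fun x => hrep (f x)
    _ = 1 + ∑' n : ℕ, ∫⁻ x, (if n < f x then ENNReal.ofReal (u (n + 1) - u n) else 0) ∂ν := by
        rw [lintegral_add_left measurable_const, lintegral_tsum fun n =>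
          (Measurable.ite (hms n) measurable_const measurable_const).aemeasurable]
        simp
    _ ≤ 1 + ENNReal.ofReal c := by
        gcongr
        exact (ENNReal.tsum_le_tsum hstep).trans hsum
    _ = _ := by rw [ENNReal.ofReal_add zero_le_one hc.le, ENNReal.ofReal_one]

lemma measure_le_mul_of_weakPolyTail {X : Type*} [MeasurableSpace X] {ν : Measure X} {f : X → ℕ}
    {β c : ℝ} (hβ : 0 < β) (hc : 0 < c) (h : WeakPolyTail ν (fun x => (f x : ℕ∞)) β c) {t N : ℕ}
    (ht : 1 ≤ t) (hN : 1 ≤ N) :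
    ν {x | t ≤ N * f x} ≤ ENNReal.ofReal ((N : ℝ) ^ β) * ENNReal.ofReal (c * (t : ℝ) ^ (-β)) := by
  have hN0 : (0 : ℝ) < N := by exact_mod_cast hN
  have ht0 : (0 : ℝ) < t := by exact_mod_cast ht
  have hk : 1 ≤ ⌈(t : ℝ) / N⌉₊ := Nat.one_le_iff_ne_zero.2 (Nat.ceil_pos.2 (by positivity)).ne'
  have hset : {x | t ≤ N * f x} ⊆ {x | ((⌈(t : ℝ) / N⌉₊ : ℕ) : ℕ∞) ≤ (f x : ℕ∞)} := by
    intro x hx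
    have hx' : t ≤ N * f x := hx
    change ((⌈(t : ℝ) / N⌉₊ : ℕ) : ℕ∞) ≤ (f x : ℕ∞)
    rw [Nat.cast_le, Nat.ceil_le, div_le_iff₀ hN0]
    have : (t : ℝ) ≤ N * f x := by exact_mod_cast hx'
    linarith
  refine (measure_mono hset).trans ((h _ hk).trans ?_)
  rw [← ENNReal.ofReal_mul (by positivity)]
  apply ENNReal.ofReal_le_ofReal
  have h1 : ((⌈(t : ℝ) / N⌉₊ : ℕ) : ℝ) ^ (-β) ≤ ((t : ℝ) / N) ^ (-β) :=
    Real.rpow_le_rpow_of_nonpos (by positivity) (Nat.le_ceil _) (by linarith)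
  have h2 : ((t : ℝ) / N) ^ (-β) = (N : ℝ) ^ β * (t : ℝ) ^ (-β) := by
    rw [Real.div_rpow ht0.le hN0.le, Real.rpow_neg hN0.le, div_inv_eq_mul, mul_comm]
  rw [h2] at h1
  calc _ ≤ c * ((N : ℝ) ^ β * (t : ℝ) ^ (-β)) := by gcongr
    _ = _ := by ring

/-- One of the summands is at least the average. -/
lemma le_mul_or_exists_le_mul (n k : ℕ) (t : ℕ → ℕ) :
    k + ∑ i ∈ Finset.range (n + 1), t i ≤ (n + 2) * k ∨
      ∃ i ∈ Finset.range (n + 1), k + ∑ i ∈ Finset.range (n + 1), t i ≤ (n + 2) * t i := by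
  by_contra! h
  obtain ⟨h1, h2⟩ := h
  set s := k + ∑ i ∈ Finset.range (n + 1), t i with hs
  have h3 : ∑ i ∈ Finset.range (n + 1), (n + 2) * t i < ∑ _i ∈ Finset.range (n + 1), s :=
    Finset.sum_lt_sum_of_nonempty ⟨0, by simp⟩ h2
  rw [← Finset.mul_sum, Finset.sum_const, Finset.card_range, smul_eq_mul] at h3
  nlinarith

lemma rpow_add_sum_le {γ : ℝ} (h0 : 0 < γ) (h1 : γ ≤ 1) (n k : ℕ) (t : ℕ → ℕ) :
    (((k + ∑ i ∈ Finset.range n, t i : ℕ) : ℝ)) ^ γ ≤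
      (k : ℝ) ^ γ + ∑ i ∈ Finset.range n, (t i : ℝ) ^ γ := by
  induction n with
  | zero => simp
  | succ n ih =>
    rw [Finset.sum_range_succ, Finset.sum_range_succ, ← add_assoc, ← add_assoc, Nat.cast_add]
    exact (Real.rpow_add_le_add_rpow (Nat.cast_nonneg _) (Nat.cast_nonneg _) h0.le h1).trans
      (by gcongr)

/-- By convexity, a small fraction `η` of the exponent brings the exponential moment within `O(η)`
of `1`. -/
lemma exp_mul_le_one_add {η x : ℝ} (h0 : 0 ≤ η) (h1 : η ≤ 1) :
    Real.exp (η * x) ≤ 1 + η * Real.exp x := by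
  have := convexOn_exp.2 (mem_univ (0 : ℝ)) (mem_univ x) (sub_nonneg.2 h1) h0 (by ring)
  simp only [smul_eq_mul, mul_zero, zero_add, Real.exp_zero, mul_one] at this
  linarith

lemma tsum_geometric_mul_pow_le {ε : ℝ} (h0 : 0 < ε) (h1 : ε < 1) :
    ∑' n : ℕ, ENNReal.ofReal (ε * (1 - ε) ^ n) * ENNReal.ofReal (1 + ε / 2) ^ (n + 1) ≤
      ENNReal.ofReal 2 := by
  set δ := ε / 2 + ε ^ 2 / 2 with hδ
  -- `δ` is defined by `(1 - ε) (1 + ε/2) = 1 - δ`: the growth per return is beaten by the chance of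
  -- stopping.
  have hδ0 : 0 < δ := by positivity
  have hδ1 : δ ≤ 1 := by nlinarith
  have hq : (1 - ε) * (1 + ε / 2) = 1 - δ := by rw [hδ]; ring
  have key : ∀ n : ℕ, ENNReal.ofReal (ε * (1 - ε) ^ n) * ENNReal.ofReal (1 + ε / 2) ^ (n + 1) ≤
      ENNReal.ofReal 2 * ENNReal.ofReal (δ * (1 - δ) ^ n) := by
    intro n
    have h2 : 0 ≤ 1 - ε := by linarith
    rw [← ENNReal.ofReal_pow (by positivity), ← ENNReal.ofReal_mul (by positivity),
      ← ENNReal.ofReal_mul (by positivity), ← hq]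
    apply ENNReal.ofReal_le_ofReal
    rw [mul_pow, pow_succ]
    have h3 : ε * (1 + ε / 2) ≤ 2 * δ := by rw [hδ]; nlinarith
    calc ε * (1 - ε) ^ n * ((1 + ε / 2) ^ n * (1 + ε / 2))
        = ε * (1 + ε / 2) * ((1 - ε) ^ n * (1 + ε / 2) ^ n) := by ring
      _ ≤ 2 * δ * ((1 - ε) ^ n * (1 + ε / 2) ^ n) := by gcongr
      _ = _ := by ring
  refine (ENNReal.tsum_le_tsum key).trans ?_
  rw [ENNReal.tsum_mul_left, tsum_ofReal_geometric hδ0 hδ1, mul_one]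

/-- The constant of the polynomial bounds. -/
noncomputable def polyConst (p : ℝ × ℝ × ℝ × ℝ × ℝ) : ℝ :=
  2 * Real.exp 1 * (2 * (p.2.2.2.1 + 1) / splitFraction p.1 p.2.1 p.2.2.1) ^ (p.2.2.2.1 + 1) *
    (Real.exp (3 * p.2.2.1) * p.2.2.2.2)

/-- The constant of the stretched exponential bounds. -/
noncomputable def expConst (p : ℝ × ℝ × ℝ × ℝ × ℝ × ℝ) : ℝ :=
  2 * (1 + p.2.2.2.2.2)

/-- The fraction of the exponent that is lost in the stretched exponential bounds. -/
noncomputable def expFraction (lam K R c : ℝ) : ℝ :=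
  -- Chosen so that `e^{3R} η (1 + c) = ε / 2`, the growth per return allowed by
  -- `tsum_geometric_mul_pow_le`.
  splitFraction lam K R / (2 * (Real.exp (3 * R) * (1 + c)))

/-- The rate of the stretched exponential bounds. -/
noncomputable def expRate (p : ℝ × ℝ × ℝ × ℝ × ℝ × ℝ) : ℝ :=
  expFraction p.1 p.2.1 p.2.2.1 p.2.2.2.2.2 * (p.2.2.2.1 / 2)

lemma ContinuousOn.splitFraction {X : Type*} [TopologicalSpace X] {s : Set X} {l k r : X → ℝ}
    (hl : ContinuousOn l s) (hk : ContinuousOn k s) (hr : ContinuousOn r s)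
    (h : ∀ x ∈ s, 1 < l x ∧ 0 ≤ k x ∧ k x * l x / (l x - 1) < r x) :
    ContinuousOn (fun x => splitFraction (l x) (k x) (r x)) s := by
  have hl0 : ∀ x ∈ s, l x ≠ 0 := fun x hx => by linarith [(h x hx).1]
  have hr0 : ∀ x ∈ s, r x ≠ 0 := fun x hx =>
    (rate_pos (h x hx).1 (h x hx).2.1 (h x hx).2.2).ne'
  have h1 : ContinuousOn (fun x => r x / l x + k x) s := (hr.div hl hl0).add hk
  exact (Real.continuous_exp.comp_continuousOn h1.neg).mul
    (continuousOn_const.sub (h1.div hr hr0))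

lemma continuousOn_polyConst : ContinuousOn polyConst polyParams := by
  have h1 : ContinuousOn (fun p : ℝ × ℝ × ℝ × ℝ × ℝ => splitFraction p.1 p.2.1 p.2.2.1)
      polyParams :=
    ContinuousOn.splitFraction (by fun_prop) (by fun_prop) (by fun_prop)
      fun p hp => ⟨hp.1, hp.2.1, hp.2.2.1⟩
  have hpos : ∀ p ∈ polyParams, 0 < splitFraction p.1 p.2.1 p.2.2.1 := fun p hp =>
    splitFraction_pos hp.1 hp.2.1 hp.2.2.1
  have h2 : ContinuousOn (fun p : ℝ × ℝ × ℝ × ℝ × ℝ =>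
      2 * (p.2.2.2.1 + 1) / splitFraction p.1 p.2.1 p.2.2.1) polyParams :=
    ContinuousOn.div (by fun_prop) h1 fun p hp => (hpos p hp).ne'
  refine (continuousOn_const.mul (h2.rpow (by fun_prop) fun p hp => Or.inl ?_)).mul (by fun_prop)
  have := hp.2.2.2.1
  have := hpos p hp
  positivity

lemma continuousOn_expConst : ContinuousOn expConst expParams := by
  unfold expConst
  fun_prop

lemma continuousOn_expRate : ContinuousOn expRate expParams := by
  have h1 : ContinuousOn (fun p : ℝ × ℝ × ℝ × ℝ × ℝ × ℝ => splitFraction p.1 p.2.1 p.2.2.1)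
      expParams :=
    ContinuousOn.splitFraction (by fun_prop) (by fun_prop) (by fun_prop)
      fun p hp => ⟨hp.1, hp.2.1, hp.2.2.1⟩
  refine (h1.div (by fun_prop) fun p hp => ?_).mul (by fun_prop)
  have := hp.2.2.2.2.2
  positivity

lemma expFraction_pos {lam K R c : ℝ} (hlam : 1 < lam) (hK : 0 ≤ K)
    (hR : K * lam / (lam - 1) < R) (hc : 0 < c) : 0 < expFraction lam K R c :=
  div_pos (splitFraction_pos hlam hK hR) (by positivity)

lemma expFraction_le_one {lam K R c : ℝ} (hlam : 1 < lam) (hK : 0 ≤ K)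
    (hR : K * lam / (lam - 1) < R) (hc : 0 < c) : expFraction lam K R c ≤ 1 := by
  rw [expFraction, div_le_one (by positivity)]
  have h1 := splitFraction_lt_one hlam hK hR
  have h2 : 1 ≤ Real.exp (3 * R) := Real.one_le_exp (by linarith [rate_pos hlam hK hR])
  nlinarith

/-! ### The main theorem -/

/-- Both polynomial bounds, in terms of a common bound on `f`. -/
lemma tsum_split_le_polyConst {lam K R β c s : ℝ} (hlam : 1 < lam) (hK : 0 ≤ K)
    (hR : K * lam / (lam - 1) < R) (hβ : 1 < β) {A B : ℕ → ℝ≥0∞}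
    (hA : ∀ n : ℕ, A n ≤ ENNReal.ofReal (((n + 2 : ℕ) : ℝ) ^ β) * ENNReal.ofReal (c * s))
    (hB : ∀ n : ℕ, B n ≤ ENNReal.ofReal (((n + 2 : ℕ) : ℝ) ^ β) * ENNReal.ofReal (c * s)) :
    ∑' n : ℕ, ENNReal.ofReal (splitFraction lam K R * (1 - splitFraction lam K R) ^ n) *
        (A n + (n + 1) * (ENNReal.ofReal (Real.exp (3 * R)) * B n)) ≤
      ENNReal.ofReal (polyConst (lam, K, R, β, c) * s) := by
  have hε := splitFraction_pos hlam hK hR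
  have hε1 := splitFraction_lt_one hlam hK hR
  have hR0 := rate_pos hlam hK hR
  have h1 : 1 ≤ ENNReal.ofReal (Real.exp (3 * R)) := by
    rw [← ENNReal.ofReal_one]
    exact ENNReal.ofReal_le_ofReal (Real.one_le_exp (by linarith))
  set ε := splitFraction lam K R
  have key : ∀ n : ℕ, ENNReal.ofReal (ε * (1 - ε) ^ n) *
      (A n + (n + 1) * (ENNReal.ofReal (Real.exp (3 * R)) * B n)) ≤
      -- There are `n + 2` summands, each costing `(n + 2)^β`; this is where the exponent `β + 1`
      -- comes from.
      ENNReal.ofReal (ε * (1 - ε) ^ n) * ENNReal.ofReal (((n : ℝ) + 2) ^ (β + 1)) *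
        ENNReal.ofReal (Real.exp (3 * R) * c * s) := by
    intro n
    rw [mul_assoc (ENNReal.ofReal (ε * (1 - ε) ^ n))]
    gcongr ENNReal.ofReal (ε * (1 - ε) ^ n) * ?_
    set X := ENNReal.ofReal (((n + 2 : ℕ) : ℝ) ^ β) * ENNReal.ofReal (c * s) with hX
    calc A n + (n + 1) * (ENNReal.ofReal (Real.exp (3 * R)) * B n)
        ≤ ENNReal.ofReal (Real.exp (3 * R)) * X +
          (n + 1) * (ENNReal.ofReal (Real.exp (3 * R)) * X) := by
          gcongr
          · exact (hA n).trans (le_mul_of_one_le_left zero_le h1)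
          · exact hB n
      _ = ((n + 2 : ℕ) : ℝ≥0∞) * (ENNReal.ofReal (Real.exp (3 * R)) * X) := by
          push_cast; ring
      _ = _ := by
          rw [hX, ← ENNReal.ofReal_natCast, ← ENNReal.ofReal_mul (by positivity),
            ← ENNReal.ofReal_mul (by positivity), ← ENNReal.ofReal_mul (by positivity),
            ← ENNReal.ofReal_mul (by positivity)]
          congr 1
          push_cast
          rw [Real.rpow_add (by positivity), Real.rpow_one]
          ring
  refine (ENNReal.tsum_le_tsum key).trans ?_
  rw [ENNReal.tsum_mul_right]
  refine (mul_le_mul_left (tsum_geometric_mul_rpow_le hε hε1 (by linarith)) _).trans (le_of_eq ?_)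
  rw [← ENNReal.ofReal_mul (by positivity)]
  congr 1
  simp only [polyConst]
  ring

lemma measure_le_eq_lintegral_ite {X : Type*} [MeasurableSpace X] {ν : Measure X} {s : Set X}
    [DecidablePred (· ∈ s)] (hs : MeasurableSet s) :
    ∫⁻ x, (if x ∈ s then 1 else 0) ∂ν = ν s := by
  rw [← lintegral_indicator_one hs]
  exact lintegral_congr fun x => by simp [indicator_apply]

lemma monotone_ite_le (t : ℝ≥0∞) : Monotone fun x : ℝ≥0∞ => if t ≤ x then (1 : ℝ≥0∞) else 0 := by
  intro x y hxy
  by_cases hx : t ≤ x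
  · simp [hx, hx.trans hxy]
  · simp [hx]

lemma measure_mergingTime_le {M : Type*} [MeasurableSpace M] {T : M → M}
    {ρhat : Measure (M × M)} {g : M × M → ℝ≥0∞} (hg : Measurable g)
    (hle : ∀ p, (mergingTime T p : ℝ≥0∞) ≤ g p) (t : ℕ) :
    ρhat {p | (t : ℕ∞) ≤ mergingTime T p} ≤
      ∫⁻ p, (if (t : ℝ≥0∞) ≤ g p then 1 else 0) ∂ρhat := by
  have hms : MeasurableSet {p | (t : ℝ≥0∞) ≤ g p} := hg measurableSet_Ici
  refine (measure_mono fun p hp => ?_).trans_eq (measure_le_eq_lintegral_ite hms).symm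
  refine le_trans ?_ (hle p)
  have : ((t : ℕ∞) : ℝ≥0∞) ≤ mergingTime T p := ENat.toENNReal_mono hp
  simpa using this

lemma exists_merging_coupling {M : Type*} [MetricSpace M] [MeasurableSpace M] [BorelSpace M]
    {m : Measure M} {T : M → M} {Y : Set M} {α : Set (Set M)} {τ : M → ℕ} {lam Khat : ℝ}
    (N : IsNonuniformlyExpanding T m Y α τ lam Khat) {μ : Measure M}
    (hμ : IsInducedACIP T m Y τ μ) {K R : ℝ} (hK : 0 ≤ K)
    (hd : HasBoundedDistortion (inducedMap T τ) α μ K) (hR : K * lam / (lam - 1) < R)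
    {E : Type*} [MeasurableSpace E] {ρ : Measure M} {κ : Measure E} {ρz : Kernel E M} {r : E → ℕ}
    (hρ : IsForwardRegular T Y μ R ρ κ ρz r) :
    ∃ ρhat : Measure (M × M), IsProbabilityMeasure ρhat ∧
      ρhat.map Prod.fst = ρ ∧ ρhat.map Prod.snd = μ ∧ (∀ᵐ p ∂ρhat, mergingTime T p < ⊤) ∧
      (∀ β c : ℝ, 1 < β → 0 < c →
        WeakPolyTail κ (fun z => (r z : ℕ∞)) β c → WeakPolyTail μ (fun y => (τ y : ℕ∞)) β c →
        WeakPolyTail ρhat (mergingTime T) β (polyConst (lam, K, R, β, c))) ∧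
      (∀ β c : ℝ, 1 < β → 0 < c →
        ∫⁻ z, (r z : ℝ≥0∞) ^ β ∂κ ≤ ENNReal.ofReal c →
        ∫⁻ y, (τ y : ℝ≥0∞) ^ β ∂μ ≤ ENNReal.ofReal c →
        MomentBound ρhat (mergingTime T) β (polyConst (lam, K, R, β, c))) ∧
      (∀ a γ c : ℝ, 0 < a → 0 < γ → γ ≤ 1 → 0 < c →
        ExpTail κ (fun z => (r z : ℕ∞)) a γ c → ExpTail μ (fun y => (τ y : ℕ∞)) a γ c →
        ExpTail ρhat (mergingTime T) (expRate (lam, K, R, a, γ, c)) γ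
          (expConst (lam, K, R, a, γ, c))) := by
  have := hμ.isProbabilityMeasure
  have := hρ.isProbabilityMeasure
  have := hρ.isMarkovKernel
  have hlam := N.one_lt_lam
  have hε := splitFraction_pos hlam hK hR
  have hε1 := splitFraction_lt_one hlam hK hR
  have hR0 := rate_pos hlam hK hR
  have hT := N.nonsingular.measurable
  have hτm := N.measurable_cutoffTime
  have hτα : ∀ a ∈ α, ∃ k, ∀ x ∈ a, cutoffTime α τ x = k := fun a ha => by
    obtain ⟨k, hk⟩ := N.τ_const a ha
    exact ⟨k, fun x hx => by rw [cutoffTime_of_mem ha hx, hk x hx]⟩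
  have hτae := N.cutoffTime_ae_eq hμ.supported hμ.absolutelyContinuous
  have S := N.markovSystem hμ.supported hμ.absolutelyContinuous hK hd
  obtain ⟨Q, hQ, hQμ⟩ := S.exists_countable_ae_mem_closure
  have hρprob : IsProbabilityMeasure ρ := by
    rw [hρ.disintegration]
    constructor
    rw [Measure.bind_apply MeasurableSet.univ ρz.measurable.aemeasurable]
    simp
  have hsumprob : IsProbabilityMeasure (Measure.sum (jumpPart κ ρz r)) := by
    rwa [hρ.sum_jumpPart]
  obtain ⟨ρhat, g, hfst, hsnd, hg, hgle, hI, hII⟩ := exists_coupling hT hτm hτα S hR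
    (jumpPart κ ρz r)
    fun k => hρ.hasLogLipschitzDensity_jumpPart hT S.ae_mem hR0.le hQ hQμ k
  rw [hρ.sum_jumpPart] at hfst
  simp only [hρ.tsum_mul_jumpPart] at hI hII
  set τ' := cutoffTime α τ
  have htail : ∀ n : ℕ, μ {y | (n : ℕ∞) ≤ (τ' y : ℕ∞)} = μ {y | (n : ℕ∞) ≤ (τ y : ℕ∞)} :=
    fun n => measure_congr (hτae.mono fun y hy => by
      change ((n : ℕ∞) ≤ (τ' y : ℕ∞)) = ((n : ℕ∞) ≤ (τ y : ℕ∞))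
      rw [hy])
  refine ⟨ρhat, ⟨?_⟩, hfst, hsnd, ?_, ?_, ?_, ?_⟩
  · rw [← preimage_univ (f := Prod.snd), ← Measure.map_apply measurable_snd MeasurableSet.univ,
      hsnd, measure_univ]
  -- With `h` the indicator of `∞`, the bound `f = 0` is admissible because all the times are
  -- finite.
  · have h0 := hI (fun x => if ⊤ ≤ x then 1 else 0) (fun _ _ => 0) (monotone_ite_le ⊤)
      fun n k t => by simp [-Nat.cast_add, -Nat.cast_sum]
    simp only [lintegral_zero, mul_zero, add_zero, tsum_zero, nonpos_iff_eq_zero] at h0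
    have h1 := measure_le_eq_lintegral_ite (ν := ρhat) (s := {p | ⊤ ≤ g p}) (hg measurableSet_Ici)
    have h2 : ρhat {p | ⊤ ≤ g p} = 0 := h1.symm.trans h0
    refine measure_mono_null (fun p hp => ?_) h2
    have hp' : mergingTime T p = ⊤ := by simpa using hp
    have := hgle p
    rwa [hp', ENat.toENNReal_top] at this
  · intro β c hβ hc hκ hτ t ht
    refine (measure_mergingTime_le hg hgle t).trans ?_
    -- Union bound: if the sum reaches `t`, one of its `n + 2` terms is at least `t / (n + 2)`.
    refine (hI _ (fun n k => if t ≤ (n + 2) * k then 1 else 0) (monotone_ite_le t)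
      fun n k s => ?_).trans ?_
    · simp only [Nat.cast_le]
      split_ifs with h1 h2 h2
      · exact le_self_add
      · obtain h3 | ⟨i, hi, h3⟩ := le_mul_or_exists_le_mul n k s
        · exact absurd (h1.trans h3) h2
        · rw [zero_add]
          refine le_trans ?_ (Finset.single_le_sum (fun _ _ => zero_le) hi)
          simp [h1.trans h3]
      · exact zero_le
      · exact zero_le
    · refine tsum_split_le_polyConst hlam hK hR hβ (fun n => ?_) fun n => ?_
      · have h1 := measure_le_eq_lintegral_ite (ν := κ) (s := {z | t ≤ (n + 2) * r z})
          (hρ.measurable_jump (MeasurableSet.of_discrete (s := {k | t ≤ (n + 2) * k})))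
        exact h1.trans_le (measure_le_mul_of_weakPolyTail (by linarith) hc hκ ht (by omega))
      · have h1 := measure_le_eq_lintegral_ite (ν := μ) (s := {y | t ≤ (n + 2) * τ' y})
          (hτm (MeasurableSet.of_discrete (s := {k | t ≤ (n + 2) * k})))
        refine h1.trans_le (measure_le_mul_of_weakPolyTail (by linarith) hc ?_ ht (by omega))
        intro n hn
        rw [htail n]
        exact hτ n hn
  · intro β c hβ hc hκ hτ
    have hβ0 : 0 < β := by linarith
    refine ⟨g, hg, hgle, ?_⟩
    refine (hI (fun x => x ^ β) (fun n k => ENNReal.ofReal (((n + 2 : ℕ) : ℝ) ^ β) * (k : ℝ≥0∞) ^ β)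
      (fun x y hxy => ENNReal.rpow_le_rpow hxy hβ0.le) fun n k s => ?_).trans ?_
    · have hpow : ∀ j l : ℕ, j ≤ (n + 2) * l →
          (j : ℝ≥0∞) ^ β ≤ ENNReal.ofReal (((n + 2 : ℕ) : ℝ) ^ β) * (l : ℝ≥0∞) ^ β := by
        intro j l hjl
        rw [← ENNReal.ofReal_rpow_of_nonneg (Nat.cast_nonneg _) hβ0.le, ENNReal.ofReal_natCast,
          ← ENNReal.mul_rpow_of_nonneg _ _ hβ0.le]
        refine ENNReal.rpow_le_rpow ?_ hβ0.le
        exact_mod_cast hjl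
      obtain h3 | ⟨i, hi, h3⟩ := le_mul_or_exists_le_mul n k s
      · exact (hpow _ _ h3).trans le_self_add
      · refine (hpow _ _ h3).trans (le_add_left ?_)
        exact Finset.single_le_sum
          (f := fun i => ENNReal.ofReal (((n + 2 : ℕ) : ℝ) ^ β) * (s i : ℝ≥0∞) ^ β)
          (fun _ _ => zero_le) hi
    · have h0 := tsum_split_le_polyConst (c := c) (s := 1) hlam hK hR hβ
        (A := fun n => ∫⁻ z, ENNReal.ofReal (((n + 2 : ℕ) : ℝ) ^ β) * (r z : ℝ≥0∞) ^ β ∂κ)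
        (B := fun n => ∫⁻ y, ENNReal.ofReal (((n + 2 : ℕ) : ℝ) ^ β) * (τ' y : ℝ≥0∞) ^ β ∂μ)
        (fun n => ?_) fun n => ?_
      · rwa [mul_one] at h0
      · rw [lintegral_const_mul' _ _ ENNReal.ofReal_ne_top, mul_one]
        gcongr
      · rw [lintegral_const_mul' _ _ ENNReal.ofReal_ne_top, mul_one]
        gcongr
        refine le_trans (le_of_eq (lintegral_congr_ae (hτae.mono fun y hy => ?_))) hτ
        simp only [hy]
  · intro a γ c ha hγ hγ1 hc hκ hτ t ht
    have hη := expFraction_pos hlam hK hR hc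
    have hη1 := expFraction_le_one hlam hK hR hc
    set η := expFraction lam K R c with hηdef
    set A := expRate (lam, K, R, a, γ, c) with hAdef
    have hA : A = η * (a / 2) := rfl
    have hA0 : 0 < A := by rw [hA]; positivity
    have hτ' : ExpTail μ (fun y => (τ' y : ℕ∞)) a γ c := fun n hn => by
      rw [htail n]; exact hτ n hn
    have hκint := lintegral_exp_le_of_expTail hρ.measurable_jump ha hγ hc hκ
    have hμint := lintegral_exp_le_of_expTail hτm ha hγ hc hτ'
    refine (measure_mergingTime_le hg hgle t).trans ?_
    -- Chernoff bound: the indicator of `s ≥ t` is at most `e^{-A t^γ} e^{A s^γ}`, and `s^γ` is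
    -- subadditive since `γ ≤ 1`.
    refine (hII _ (ENNReal.ofReal (Real.exp (-A * (t : ℝ) ^ γ)))
      (fun k => ENNReal.ofReal (Real.exp (A * (k : ℝ) ^ γ)))
      (fun k => ENNReal.ofReal (η * Real.exp (a / 2 * (k : ℝ) ^ γ))) (monotone_ite_le t)
      fun n k s => ?_).trans ?_
    · simp only [Nat.cast_le]
      split_ifs with h1
      · have h2 : ∀ i, ENNReal.ofReal (Real.exp (A * (s i : ℝ) ^ γ)) ≤
            1 + ENNReal.ofReal (η * Real.exp (a / 2 * (s i : ℝ) ^ γ)) := fun i => by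
          rw [← ENNReal.ofReal_one, ← ENNReal.ofReal_add zero_le_one (by positivity), hA, mul_assoc]
          exact ENNReal.ofReal_le_ofReal (exp_mul_le_one_add hη.le hη1)
        refine le_trans ?_ (mul_le_mul_right (Finset.prod_le_prod' fun i _ => h2 i) _)
        rw [← ENNReal.ofReal_prod_of_nonneg fun i _ => (Real.exp_pos _).le, ← Real.exp_sum,
          ← ENNReal.ofReal_mul (by positivity), ← ENNReal.ofReal_mul (by positivity),
          ← Real.exp_add, ← Real.exp_add, ← ENNReal.ofReal_one]
        apply ENNReal.ofReal_le_ofReal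
        apply Real.one_le_exp
        rw [← Finset.mul_sum]
        have h3 := rpow_add_sum_le hγ hγ1 (n + 1) k s
        have h4 : (t : ℝ) ^ γ ≤ ((k + ∑ i ∈ Finset.range (n + 1), s i : ℕ) : ℝ) ^ γ := by
          gcongr
        nlinarith
      · exact zero_le
    · have h1 : ∫⁻ z, ENNReal.ofReal (Real.exp (A * (r z : ℝ) ^ γ)) ∂κ ≤ ENNReal.ofReal (1 + c) := by
        refine (lintegral_mono fun z => ENNReal.ofReal_le_ofReal (Real.exp_le_exp.2 ?_)).trans hκint
        have : A ≤ a / 2 := by rw [hA]; nlinarith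
        gcongr
      have h2 : ENNReal.ofReal (Real.exp (3 * R)) *
          ∫⁻ y, ENNReal.ofReal (η * Real.exp (a / 2 * (τ' y : ℝ) ^ γ)) ∂μ ≤
          ENNReal.ofReal (splitFraction lam K R / 2) := by
        simp_rw [ENNReal.ofReal_mul hη.le]
        rw [lintegral_const_mul' _ _ ENNReal.ofReal_ne_top]
        calc _ ≤ ENNReal.ofReal (Real.exp (3 * R)) * (ENNReal.ofReal η * ENNReal.ofReal (1 + c)) := by
              gcongr
          _ = _ := by
              rw [← ENNReal.ofReal_mul hη.le, ← ENNReal.ofReal_mul (by positivity)]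
              congr 1
              rw [hηdef, expFraction]
              field_simp
      have h3 : 1 + ENNReal.ofReal (Real.exp (3 * R)) *
          ∫⁻ y, ENNReal.ofReal (η * Real.exp (a / 2 * (τ' y : ℝ) ^ γ)) ∂μ ≤
          ENNReal.ofReal (1 + splitFraction lam K R / 2) := by
        rw [ENNReal.ofReal_add zero_le_one (by positivity), ENNReal.ofReal_one]
        gcongr
      calc _ ≤ ENNReal.ofReal (Real.exp (-A * (t : ℝ) ^ γ)) * ENNReal.ofReal (1 + c) *
            ∑' n : ℕ, ENNReal.ofReal (splitFraction lam K R * (1 - splitFraction lam K R) ^ n) *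
              ENNReal.ofReal (1 + splitFraction lam K R / 2) ^ (n + 1) := by
            gcongr
        _ ≤ ENNReal.ofReal (Real.exp (-A * (t : ℝ) ^ γ)) * ENNReal.ofReal (1 + c) *
            ENNReal.ofReal 2 := by
            gcongr
            exact tsum_geometric_mul_pow_le hε hε1
        _ = _ := by
            rw [← ENNReal.ofReal_mul (by positivity), ← ENNReal.ofReal_mul (by positivity)]
            congr 1
            simp only [expConst]
            ring

theorem mainTheorem2 :
    ∃ (Kf : ℝ × ℝ → ℝ)
      (Cw Cs : ℝ × ℝ × ℝ × ℝ × ℝ → ℝ) (Ce Ae : ℝ × ℝ × ℝ × ℝ × ℝ × ℝ → ℝ),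
      ContinuousOn Kf {p | 1 < p.1 ∧ 0 ≤ p.2} ∧
      ContinuousOn Cw polyParams ∧ ContinuousOn Cs polyParams ∧
      ContinuousOn Ce expParams ∧ ContinuousOn Ae expParams ∧
      (∀ p ∈ expParams, 0 < Ce p ∧ 0 < Ae p) ∧
      ∀ (M : Type*) [MetricSpace M] [MeasurableSpace M] [BorelSpace M]
        (m : Measure M) [IsProbabilityMeasure m]
        (T : M → M) (Y : Set M) (α : Set (Set M)) (τ : M → ℕ) (lam Khat : ℝ),
        IsNonuniformlyExpanding T m Y α τ lam Khat →
        (∃! μ : Measure M, IsInducedACIP T m Y τ μ) ∧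
        ∀ μ : Measure M, IsInducedACIP T m Y τ μ →
          (0 < Kf (lam, Khat) ∧
            (∀ᵐ y ∂(cond m Y),
              ENNReal.ofReal (Kf (lam, Khat))⁻¹ ≤ μ.rnDeriv (cond m Y) y ∧
                μ.rnDeriv (cond m Y) y ≤ ENNReal.ofReal (Kf (lam, Khat))) ∧
            HasBoundedDistortion (inducedMap T τ) α μ (Kf (lam, Khat))) ∧
          ∀ K R : ℝ, 0 ≤ K → HasBoundedDistortion (inducedMap T τ) α μ K →
            K * lam / (lam - 1) < R →
            ∀ (E : Type*) [MeasurableSpace E] (ρ : Measure M) (κ : Measure E)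
              (ρz : Kernel E M) (r : E → ℕ),
              IsForwardRegular T Y μ R ρ κ ρz r →
              ∃ ρhat : Measure (M × M),
                IsProbabilityMeasure ρhat ∧
                ρhat.map Prod.fst = ρ ∧ ρhat.map Prod.snd = μ ∧
                (∀ᵐ p ∂ρhat, mergingTime T p < ⊤) ∧
                (∀ β c : ℝ, 1 < β → 0 < c →
                  WeakPolyTail κ (fun z => (r z : ℕ∞)) β c →
                  WeakPolyTail μ (fun y => (τ y : ℕ∞)) β c →
                  WeakPolyTail ρhat (mergingTime T) β (Cw (lam, K, R, β, c))) ∧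
                (∀ β c : ℝ, 1 < β → 0 < c →
                  ∫⁻ z, (r z : ℝ≥0∞) ^ β ∂κ ≤ ENNReal.ofReal c →
                  ∫⁻ y, (τ y : ℝ≥0∞) ^ β ∂μ ≤ ENNReal.ofReal c →
                  MomentBound ρhat (mergingTime T) β (Cs (lam, K, R, β, c))) ∧
                (∀ a γ c : ℝ, 0 < a → 0 < γ → γ ≤ 1 → 0 < c →
                  ExpTail κ (fun z => (r z : ℕ∞)) a γ c →
                  ExpTail μ (fun y => (τ y : ℕ∞)) a γ c →
                  ExpTail ρhat (mergingTime T) (Ae (lam, K, R, a, γ, c)) γ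
                    (Ce (lam, K, R, a, γ, c))) := by
  refine ⟨IsNonuniformlyExpanding.densityBound, polyConst, polyConst, expConst, expRate,
    IsNonuniformlyExpanding.continuousOn_densityBound, continuousOn_polyConst,
    continuousOn_polyConst, continuousOn_expConst, continuousOn_expRate, fun p hp => ⟨?_, ?_⟩, ?_⟩
  · have := hp.2.2.2.2.2
    unfold expConst
    positivity
  · exact mul_pos (expFraction_pos hp.1 hp.2.1 hp.2.2.1 hp.2.2.2.2.2) (half_pos hp.2.2.2.1)
  · intro M _ _ _ m _ T Y α τ lam Khat N
    refine ⟨N.exists_unique_isInducedACIP, fun μ hμ => ⟨N.density_and_distortion_bounds hμ, ?_⟩⟩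
    intro K R hK hd hR E _ ρ κ ρz r hρ
    exact exists_merging_coupling N hμ hK hd hR hρ
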